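/- **Setting.** A Wiener moustache $\eta\subset\mathbb C$ is the union of the ranges of two planar paths $R^{(j)}_te^{i\Theta^{(j)}_t}$, $t\ge 0$, $j=1,2$, with $$dR_t=\Big(\frac1{R_t\ln R_t}+\frac1{2R_t}\Big)dt+dW^{(1)}_t,\qquad d\Theta_t=\frac1{R_t}\,dW^{(2)}_t,\qquad (R_0,\Theta_0)=(1,U),\quad R_t>1\text{ for }t>0,$$ where $U$ is uniform on $[0,2\pi]$, common to $j=1,2$, and the standard Brownian motions $W^{(1)},W^{(2)}$ for $j=1,2$ are independent of each other and of $U$. Let $(x_k,u_k)_{k}$ be the points of a Poisson point process of rate $1$ on $\mathbb R\times\mathbb R_+$ and let $(\eta_k)_k$ be an independent sequence of i.i.d. Wiener moustaches. For $\alpha>0$ let $$\mathrm{BRI}(\alpha)=\bigcup_{k:\;u_k\le 2\alpha,\;e^{x_k}\ge 1}e^{x_k}\eta_k,\qquad \Phi_0(\alpha)=\mathrm{dist}\big(0,\mathrm{BRI}(\alpha)\big),$$ simultaneously for all $\alpha>0$, and let $$Y(\beta)=\beta+\ln\ln\Phi_0(e^\beta)+\ln 2,\qquad \beta\in\mathbb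 R .$$ **Theorem.** Almost surely $\Phi_0(\alpha)>1$ for all $\alpha>0$, so that $Y$ is well defined, and $Y$ is a stationary, time-homogeneous Markov process (with respect to its natural filtration) with unit drift in the positive direction, jump rate $e^y$, and jumps distributed as the negative of an $\mathrm{Exp}(1)$ random variable. More precisely: 1. Almost surely $Y$ has càdlàg paths with finitely many jumps in each bounded interval, and it solves $$dY(\beta)=d\beta-\mathcal E_\beta\,dN(\beta),$$ where $N$ is a point process with stochastic intensity $\exp Y(\beta)$ and marks $\mathcal E_\beta$ with $\mathrm{Exp}(1)$-distribution, with respect to the natural filtration of $Y$. That is, the marked point process of the jumps of $Y$ has finite mean number of points on bounded time intervals and compensator $e^{Y(\beta)}d\beta\otimes e^{-u}\mathbf 1_{u>0}\,du$. 2. There is a semigroup $(P_t)_{t\ge0}$ of Markov transition kernels of $Y$ whose infinitesimal generator is given, for every $C^1$ function $f:\mathbb R\to\mathbb R$ with $\int_0^\infty|f(y-u)|e^{-u}du<\infty$ for all $y$, by $$\lim_{t\downarrow0}\frac{P_tf(y)-f(y)}t=\mathcal Lf(y)= f'(y)+e^y\int_0^{\infty}\big[f(y-u)-f(y)\big]e^{-u}\,du\qquad\text{for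 every }y\in\mathbb R,$$ where $P_tf(y)$ is a convergent integral. 3. The unique invariant probability measure of $(P_t)$ is the law of the negative of a standard Gumbel variable (a variable with distribution function $x\mapsto\exp(-e^{-x})$); it has density $\exp\{y-e^y\}$ on $\mathbb R$. It is the law of $Y(\beta)$ for every $\beta$. -/

import Mathlib

open MeasureTheory ProbabilityTheory Set Filter Topology
open scoped NNReal ENNReal

noncomputable section

namespace BrownianInterlacement

variable {Ω : Type*} [MeasurableSpace Ω]

/-! ### Poisson point processes -/

/-- Number (with multiplicity) of the points `X k ω`, `k ∈ ℕ`, lying in `A`. -/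
def pointCount {E : Type*} (X : ℕ → Ω → E) (A : Set E) (ω : Ω) : ℝ≥0∞ :=
  ∑' k, A.indicator 1 (X k ω)

/-- The random points `X 0, X 1, …` form a Poisson point process with intensity measure `ν`
(of infinite total mass, so that the points can be listed as a sequence). -/
structure IsPoissonPointProcess {E : Type*} [MeasurableSpace E] (X : ℕ → Ω → E)
    (ν : Measure E) (P : Measure Ω) : Prop where
  measurable : ∀ k, Measurable (X k)
  hasLaw_count : ∀ A, MeasurableSet A → ν A ≠ ∞ →
    HasLaw (pointCount X A) ((poissonMeasure (ν A).toNNReal).map (Nat.cast : ℕ → ℝ≥0∞)) P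
  indep_count : ∀ (n : ℕ) (A : Fin n → Set E), (∀ i, MeasurableSet (A i)) →
    Pairwise (fun i j => Disjoint (A i) (A j)) → iIndepFun (fun i => pointCount X (A i)) P

/-! ### The Wiener moustache -/

/-- Drift of the radial part of planar Brownian motion conditioned to stay outside the
unit disk. -/
def radialDrift (r : ℝ) : ℝ := 1 / (r * Real.log r) + 1 / (2 * r)

/-- Riemann sum, along the `n`-th dyadic subdivision of `[0, t]`, of the Itô integral
`∫₀ᵗ H dW`. -/
def itoSum (H W : ℝ≥0 → Ω → ℝ) (t : ℝ≥0) (n : ℕ) (ω : Ω) : ℝ :=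
  ∑ i ∈ Finset.range (2 ^ n),
    H (i * t / 2 ^ n) ω * (W ((i + 1) * t / 2 ^ n) ω - W (i * t / 2 ^ n) ω)

/-- A Wiener moustache. Each of its two arms `j` is, in polar coordinates, a solution
`(radius j, arg j)` of
`dR = (1 / (R ln R) + 1 / (2R)) dt + dW¹`, `dΘ = (1 / R) dW²`
with `W¹ = noise j 0`, `W² = noise j 1`. Both arms start at `(1, angle)`, with a uniform angle,
and they are driven by independent Brownian motions. -/
structure WienerMoustache (P : Measure Ω) where
  angle : Ω → ℝ
  noise : Fin 2 → Fin 2 → ℝ≥0 → Ω → ℝ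
  radius : Fin 2 → ℝ≥0 → Ω → ℝ
  arg : Fin 2 → ℝ≥0 → Ω → ℝ
  measurable_angle : Measurable angle
  measurable_radius : ∀ j t, Measurable (radius j t)
  measurable_arg : ∀ j t, Measurable (arg j t)
  angle_uniform : pdf.IsUniform angle (Icc 0 (2 * Real.pi)) P
  noise_brownian : ∀ j i, IsBrownianReal (noise j i) P
  noise_indep : iIndepFun (fun (q : Fin 2 × Fin 2) ω t => noise q.1 q.2 t ω) P
  angle_indep : IndepFun angle (fun ω j i t => noise j i t ω) P
  radius_continuous : ∀ j, ∀ᵐ ω ∂P, Continuous (fun t => radius j t ω)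
  radius_zero : ∀ j, ∀ᵐ ω ∂P, radius j 0 ω = 1
  one_lt_radius : ∀ j, ∀ᵐ ω ∂P, ∀ t, 0 < t → 1 < radius j t ω
  radius_sde : ∀ j, ∀ᵐ ω ∂P, ∀ t : ℝ≥0,
    IntervalIntegrable (fun s => radialDrift (radius j s.toNNReal ω)) volume 0 t ∧
    radius j t ω = 1 + (∫ s in (0 : ℝ)..t, radialDrift (radius j s.toNNReal ω)) + noise j 0 t ω
  arg_continuous : ∀ j, ∀ᵐ ω ∂P, Continuous (fun t => arg j t ω)
  arg_zero : ∀ j, ∀ᵐ ω ∂P, arg j 0 ω = angle ω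
  arg_sde : ∀ j, ∀ t : ℝ≥0,
    TendstoInMeasure P (itoSum (fun s ω => (radius j s ω)⁻¹) (noise j 1) t) atTop
      (fun ω => arg j t ω - arg j 0 ω)

/-- The moustache as a random subset of the plane: the union of the ranges of its arms. -/
def WienerMoustache.range {P : Measure Ω} (η : WienerMoustache P) (ω : Ω) : Set ℂ :=
  {z | ∃ (j : Fin 2) (t : ℝ≥0),
    z = (η.radius j t ω : ℂ) * Complex.exp (Complex.I * (η.arg j t ω : ℂ))}

/-! ### Two-dimensional Brownian random interlacements, simultaneously for all levels -/

/-- The randomness of the interlacements: a Poisson point process of rate `1` on `ℝ × ℝ₊` and an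
independent sequence of i.i.d. Wiener moustaches, one attached to each point. (The moustaches are
functions of their driving noises, so independence is expressed through the latter.) -/
structure Model (P : Measure Ω) where
  point : ℕ → Ω → ℝ × ℝ
  moustache : ℕ → WienerMoustache P
  poisson : IsPoissonPointProcess point
    ((volume : Measure ℝ).prod ((volume : Measure ℝ).restrict (Ici 0))) P
  moustache_indep : iIndepFun
    (fun k ω => ((moustache k).angle ω, fun j i t => (moustache k).noise j i t ω)) P
  point_indep : IndepFun (fun ω k => point k ω)
    (fun ω k => ((moustache k).angle ω, fun j i t => (moustache k).noise j i t ω)) P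

namespace Model

variable {P : Measure Ω} (M : Model P)

/-- `BRI(α; b)`: the moustaches attached to the points `(x, u)` with `u ≤ 2α` and `exp x ≥ b`,
scaled by the factor `exp x`. -/
def bri (α b : ℝ) (ω : Ω) : Set ℂ :=
  ⋃ k ∈ {k | (M.point k ω).2 ≤ 2 * α ∧ b ≤ Real.exp (M.point k ω).1},
    (fun z => (Real.exp (M.point k ω).1 : ℂ) * z) '' (M.moustache k).range ω

/-- `Φ_x(α)`, the distance from `x` to `BRI(α) = BRI(α; 1)`. -/
def Φ (x : ℂ) (α : ℝ) (ω : Ω) : ℝ := Metric.infDist x (M.bri α 1 ω)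

/-- `Y(β) = β + ln ln Φ₀(e^β) + ln 2`. -/
def Y (β : ℝ) (ω : Ω) : ℝ :=
  β + Real.log (Real.log (M.Φ 0 (Real.exp β) ω)) + Real.log 2

end Model

/-! ### Real-valued processes indexed by the whole real line -/

/-- The law of the whole path is invariant under time shifts. -/
def IsStationary (X : ℝ → Ω → ℝ) (P : Measure Ω) : Prop :=
  ∀ h : ℝ, IdentDistrib (fun ω t => X (t + h) ω) (fun ω t => X t ω) P P

/-- The event that the past `(X s)_{s ≤ t}` of the process lies in `A`. As `A` varies over the
measurable sets, these are the events of the σ-algebra generated by `X s`, `s ≤ t`. -/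
def pastEvent (X : ℝ → Ω → ℝ) (t : ℝ) (A : Set (Iic t → ℝ)) : Set Ω :=
  {ω | (fun s : Iic t => X s ω) ∈ A}

/-- A semigroup of Markov transition kernels on `ℝ`. -/
structure IsMarkovSemigroup (κ : ℝ≥0 → Kernel ℝ ℝ) : Prop where
  markov : ∀ t, IsMarkovKernel (κ t)
  zero : κ 0 = Kernel.id
  add : ∀ s t, κ (s + t) = κ t ∘ₖ κ s

/-- `X` is a (time-homogeneous) Markov process with transition kernels `κ`, with respect to its
natural filtration: `P[X (s + t) ∈ B | X r, r ≤ s] = κ t (X s) B`. -/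
def IsMarkovProcess (X : ℝ → Ω → ℝ) (κ : ℝ≥0 → Kernel ℝ ℝ) (P : Measure Ω) : Prop :=
  ∀ (s : ℝ) (t : ℝ≥0) (A : Set (Iic s → ℝ)) (B : Set ℝ), MeasurableSet A → MeasurableSet B →
    P (pastEvent X s A ∩ {ω | X (s + t) ω ∈ B}) =
      ∫⁻ ω in pastEvent X s A, κ t (X s ω) B ∂P

/-- `ℒ f (y) = f'(y) + e^y ∫₀^∞ [f(y - u) - f(y)] e^{-u} du`. -/
def generator (f : ℝ → ℝ) (y : ℝ) : ℝ :=
  deriv f y + Real.exp y * ∫ u in Ioi (0 : ℝ), (f (y - u) - f y) * Real.exp (-u)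

/-- The measure with density `exp (y - e^y)`. -/
def negGumbel : Measure ℝ :=
  volume.withDensity fun y => ENNReal.ofReal (Real.exp (y - Real.exp y))

/-- Size `X(t-) - X(t)` of the downward jump of `X` at time `t`. -/
def jumpSize (X : ℝ → Ω → ℝ) (ω : Ω) (t : ℝ) : ℝ :=
  Function.leftLim (fun s => X s ω) t - X t ω

/-- Jump times of `X` in `(s, t]`. -/
def jumpTimes (X : ℝ → Ω → ℝ) (ω : Ω) (s t : ℝ) : Set ℝ :=
  {r ∈ Ioc s t | jumpSize X ω r ≠ 0}

/-- Number of the jumps of `X` in `(s, t]` whose size lies in `A`. -/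
def jumpCount (X : ℝ → Ω → ℝ) (s t : ℝ) (A : Set ℝ) (ω : Ω) : ℝ≥0∞ :=
  ({r ∈ jumpTimes X ω s t | jumpSize X ω r ∈ A}.encard : ℝ≥0∞)

/-- `X` has càdlàg paths and solves `dX(t) = dt - ℰ_t dN(t)`, where `N` is a point process with
stochastic intensity `rate (X t)` and marks `ℰ_t` of law `m`, with respect to the natural
filtration of `X`. The points of `N` and their marks are the jump times and jump sizes of `X`;
the `intensity` clause says that for each mark set `A` the process
`N((s, t] × A) - m(A) ∫ₛᵗ rate (X r) dr`, `t ≥ s`, is a martingale. -/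
structure SolvesJumpSDE (X : ℝ → Ω → ℝ) (rate : ℝ → ℝ) (m : Measure ℝ) (P : Measure Ω) :
    Prop where
  cadlag : ∀ᵐ ω ∂P, ∀ t, ContinuousWithinAt (fun s => X s ω) (Ici t) t ∧
    ∃ l, Tendsto (fun s => X s ω) (𝓝[<] t) (𝓝 l)
  equation : ∀ᵐ ω ∂P, ∀ s t, s ≤ t → (jumpTimes X ω s t).Finite ∧
    X t ω - X s ω = (t - s) - ∑ᶠ r ∈ jumpTimes X ω s t, jumpSize X ω r
  aemeasurable_jumpCount : ∀ s t A, MeasurableSet A → AEMeasurable (jumpCount X s t A) P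
  finite_intensity : ∀ s t,
    ∫⁻ ω, (∫⁻ r in Ioc s t, ENNReal.ofReal (rate (X r ω))) ∂P < ∞
  intensity : ∀ s t, s ≤ t →
    ∀ (F : Set (Iic s → ℝ)) (A : Set ℝ), MeasurableSet F → MeasurableSet A →
      ∫⁻ ω in pastEvent X s F, jumpCount X s t A ω ∂P =
        m A * ∫⁻ ω in pastEvent X s F,
          (∫⁻ r in Ioc s t, ENNReal.ofReal (rate (X r ω))) ∂P

end BrownianInterlacement

end

noncomputable section

/-
Let `L β` be the smallest abscissa in `[0, ∞)` of a point of height at most `2 e^β`. All moustaches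
are at distance one from the origin, so that `Φ₀(e^β) = exp (L β)` and `Y β = β + log (2 L β)`.
Hence `y < Y β` if and only if the box `[0, e^(y - β) / 2] × [0, 2 e^β]`, of area `e^y`, contains no
point, and the finite-dimensional laws of `Y` are void probabilities of unions of such boxes. The
boxes are permuted by the measure-preserving maps `(x, u) ↦ (e^h x, e^(-h) u)`, which gives
stationarity. Splitting off the part of a union above height `2 e^s` gives the Markov property, with
the explicit transition probability `exp (-(1 - e^(-t)) e^z)` of exceeding `z < y + t` from `y` in
time `t`; the semigroup, its generator and its invariant law are read off from this formula.

Between its jumps `Y` has slope one, so the jumps in `(s, t]` are counted by the intervals of a fine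
subdivision over which `Y` falls short of its drift. The Markov property turns the mean of this
count, on an event of the past, into a Riemann sum for the integral of the intensity `e^Y`.
-/

namespace BrownianInterlacement

/-! ### The exponential distribution and the negative Gumbel distribution -/

lemma expMeasure_one_eq : expMeasure 1 =
    ((volume : Measure ℝ).restrict (Ioi 0)).withDensity
      (fun v => ENNReal.ofReal (Real.exp (-v))) := by
  have h : expMeasure 1 = volume.withDensity (exponentialPDF 1) := rfl
  rw [h, ← withDensity_indicator measurableSet_Ioi]
  refine withDensity_congr_ae ?_
  filter_upwards [Measure.ae_ne volume 0] with v hv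
  rcases lt_or_gt_of_ne hv with hv | hv
  · rw [exponentialPDF_of_neg hv, indicator_of_notMem (by simp [hv.le])]
  · rw [exponentialPDF_of_nonneg hv.le, indicator_of_mem (mem_Ioi.2 hv), one_mul, one_mul]

instance isProbabilityMeasure_expMeasure_one : IsProbabilityMeasure (expMeasure 1) :=
  isProbabilityMeasure_expMeasure one_pos

lemma integrable_expMeasure_one_iff {f : ℝ → ℝ} :
    Integrable f (expMeasure 1) ↔ IntegrableOn (fun u => f u * Real.exp (-u)) (Ioi 0) := by
  rw [expMeasure_one_eq, integrable_withDensity_iff (by fun_prop) (by simp)]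
  simp [IntegrableOn, ENNReal.toReal_ofReal, Real.exp_nonneg]

lemma integral_expMeasure_one (f : ℝ → ℝ) :
    ∫ u, f u ∂(expMeasure 1) = ∫ u in Ioi (0 : ℝ), f u * Real.exp (-u) := by
  rw [expMeasure_one_eq, integral_withDensity_eq_integral_toReal_smul (by fun_prop) (by simp)]
  simp [ENNReal.toReal_ofReal, Real.exp_nonneg, mul_comm]

lemma ext_of_Ioi {α : Type*} [TopologicalSpace α] [SecondCountableTopology α] [LinearOrder α]
    [OrderTopology α] [MeasurableSpace α] [BorelSpace α] {μ ν : Measure α}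
    [IsProbabilityMeasure μ] [IsProbabilityMeasure ν] (h : ∀ z, μ (Ioi z) = ν (Ioi z)) :
    μ = ν := by
  refine ext_of_generate_finite (range Ioi)
    (BorelSpace.measurable_eq.trans (borel_eq_generateFrom_Ioi α)) isPiSystem_Ioi ?_ (by simp)
  rintro _ ⟨z, rfl⟩
  exact h z

lemma lintegral_Ioi_ofReal_deriv {F F' : ℝ → ℝ} {a l : ℝ} (hF : ∀ x, HasDerivAt F (F' x) x)
    (hF' : ∀ x, 0 ≤ F' x) (hl : Tendsto F atTop (𝓝 l)) :
    ∫⁻ x in Ioi a, ENNReal.ofReal (F' x) = ENNReal.ofReal (l - F a) := by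
  have hint : IntegrableOn F' (Ioi a) :=
    integrableOn_Ioi_deriv_of_nonneg' (fun x _ => hF x) (fun x _ => hF' x) hl
  rw [← ofReal_integral_eq_lintegral_ofReal hint (ae_of_all _ hF'),
    integral_Ioi_of_hasDerivAt_of_tendsto' (fun x _ => hF x) hint hl]

lemma negGumbel_Ioi (z : ℝ) :
    negGumbel (Ioi z) = ENNReal.ofReal (Real.exp (-Real.exp z)) := by
  have hd (x : ℝ) : HasDerivAt (fun y => -Real.exp (-Real.exp y))
      (Real.exp (x - Real.exp x)) x := by
    convert! ((Real.hasDerivAt_exp x).neg.exp).neg using 1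
    rw [sub_eq_add_neg, Real.exp_add, Pi.neg_apply]
    ring
  have ht : Tendsto (fun y => -Real.exp (-Real.exp y)) atTop (𝓝 0) := by
    rw [← neg_zero]
    exact (Real.tendsto_exp_neg_atTop_nhds_zero.comp Real.tendsto_exp_atTop).neg
  rw [negGumbel, withDensity_apply _ measurableSet_Ioi,
    lintegral_Ioi_ofReal_deriv hd (fun x => (Real.exp_pos _).le) ht, zero_sub, neg_neg]

instance nullSingletonClass_negGumbel : NullSingletonClass negGumbel :=
  nullSingletonClass_withDensity _

lemma tendsto_measure_Ioi_atBot {α : Type*} [MeasurableSpace α] [Preorder α] [NoMinOrder α]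
    [(atBot : Filter α).IsCountablyGenerated] (μ : Measure α) :
    Tendsto (fun x => μ (Ioi x)) atBot (𝓝 (μ univ)) := by
  rw [← iUnion_Ioi]
  exact tendsto_measure_iUnion_atBot antitone_Ioi

instance isProbabilityMeasure_negGumbel : IsProbabilityMeasure negGumbel := by
  have hlim : Tendsto (fun z => negGumbel (Ioi z)) atBot (𝓝 1) := by
    simp_rw [negGumbel_Ioi]
    have h := (Real.continuous_exp.tendsto (-0)).comp Real.tendsto_exp_atBot.neg
    simpa [Function.comp_def] using ENNReal.tendsto_ofReal h
  exact ⟨tendsto_nhds_unique (tendsto_measure_Ioi_atBot negGumbel) hlim⟩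

lemma negGumbel_map_neg_Iic (x : ℝ) : (negGumbel.map fun y => -y) (Iic x) =
    ENNReal.ofReal (Real.exp (-Real.exp (-x))) := by
  have hpre : (fun y : ℝ => -y) ⁻¹' Iic x = Ici (-x) := by simp
  rw [Measure.map_apply measurable_neg measurableSet_Iic, hpre, ← negGumbel_Ioi,
    measure_congr Ioi_ae_eq_Ici]

/-! ### The transition kernels -/

section TransitionKernel

/-- The integral `∫₀ᵗ e^(y + s) ds` of the jump rate along the path `s ↦ y + s` of a process
that starts from `y` and has not jumped yet. -/
def jumpIntensity (t y : ℝ) : ℝ := (Real.exp t - 1) * Real.exp y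

lemma jumpIntensity_nonneg {t : ℝ} (ht : 0 ≤ t) (y : ℝ) : 0 ≤ jumpIntensity t y :=
  mul_nonneg (sub_nonneg.2 (Real.one_le_exp ht)) (Real.exp_pos y).le

lemma jumpIntensity_eq (t y : ℝ) :
    jumpIntensity t y = (1 - Real.exp (-t)) * Real.exp (y + t) := by
  have h : Real.exp (-t) * Real.exp t = 1 := by rw [← Real.exp_add, neg_add_cancel, Real.exp_zero]
  rw [jumpIntensity, Real.exp_add]
  linear_combination Real.exp y * h

/-- The defective law of a positive drop: the drop is at most `v` when a Poisson number of points
of mean `c e^(-v)` vanishes, and the missing mass `e^(-c)` is that of the drop `0`. The density is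
taken with respect to `Exp(1)`, the law to which `dropLaw c / c` converges as `c → 0`. -/
def dropLaw (c : ℝ) : Measure ℝ :=
  (expMeasure 1).withDensity fun v => ENNReal.ofReal (c * Real.exp (-(c * Real.exp (-v))))

lemma dropLaw_apply (c : ℝ) {A : Set ℝ} (hA : MeasurableSet A) : dropLaw c A =
    ∫⁻ v in A ∩ Ioi 0, ENNReal.ofReal (Real.exp (-v) * (c * Real.exp (-(c * Real.exp (-v))))) := by
  rw [dropLaw, withDensity_apply _ hA, expMeasure_one_eq, restrict_withDensity hA,
    lintegral_withDensity_eq_lintegral_mul _ (by fun_prop) (by fun_prop),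
    Measure.restrict_restrict hA]
  refine lintegral_congr fun v => ?_
  rw [Pi.mul_apply, ← ENNReal.ofReal_mul (Real.exp_pos _).le]

instance nullSingletonClass_dropLaw (c : ℝ) : NullSingletonClass (dropLaw c) := by
  rw [dropLaw, expMeasure_one_eq]
  infer_instance

variable {c : ℝ}

lemma dropLaw_Ioi (hc : 0 ≤ c) {a : ℝ} (ha : 0 ≤ a) :
    dropLaw c (Ioi a) = ENNReal.ofReal (1 - Real.exp (-(c * Real.exp (-a)))) := by
  have hd (v : ℝ) : HasDerivAt (fun v => Real.exp (-(c * Real.exp (-v))))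
      (Real.exp (-v) * (c * Real.exp (-(c * Real.exp (-v))))) v := by
    convert! ((((hasDerivAt_neg v).exp).const_mul c).fun_neg).exp using 1
    ring
  have hl : Tendsto (fun v => Real.exp (-(c * Real.exp (-v)))) atTop (𝓝 1) := by
    simpa [Function.comp_def] using (Real.continuous_exp.tendsto (-(c * 0))).comp
      ((Real.tendsto_exp_neg_atTop_nhds_zero.const_mul c).neg)
  rw [dropLaw_apply c measurableSet_Ioi, Ioi_inter_Ioi, sup_eq_left.2 ha,
    lintegral_Ioi_ofReal_deriv hd (fun v => by positivity) hl]

lemma dropLaw_Iic_zero (c : ℝ) : dropLaw c (Iic 0) = 0 := by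
  rw [dropLaw_apply c measurableSet_Iic, Iic_inter_Ioi, Ioc_self, setLIntegral_empty]

lemma dropLaw_univ (hc : 0 ≤ c) : dropLaw c univ = ENNReal.ofReal (1 - Real.exp (-c)) := by
  rw [← Iic_union_Ioi (a := (0 : ℝ)), measure_union (Iic_disjoint_Ioi le_rfl) measurableSet_Ioi,
    dropLaw_Iic_zero, zero_add, dropLaw_Ioi hc le_rfl]
  simp

lemma dropLaw_Iio_of_nonpos (c : ℝ) {a : ℝ} (ha : a ≤ 0) : dropLaw c (Iio a) = 0 :=
  measure_mono_null (fun _ hx => (mem_Iio.1 hx).le.trans ha) (dropLaw_Iic_zero c)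

lemma dropLaw_Iio (hc : 0 ≤ c) {a : ℝ} (ha : 0 ≤ a) : dropLaw c (Iio a) =
    ENNReal.ofReal (Real.exp (-(c * Real.exp (-a))) - Real.exp (-c)) := by
  have hle : Real.exp (-(c * Real.exp (-a))) ≤ 1 :=
    Real.exp_le_one_iff.2 (neg_nonpos.2 (by positivity))
  rw [← compl_Ici, measure_compl measurableSet_Ici, ← measure_congr Ioi_ae_eq_Ici,
    dropLaw_univ hc, dropLaw_Ioi hc ha, ← ENNReal.ofReal_sub _ (sub_nonneg.2 hle)]
  · congr 1
    ring
  · rw [← measure_congr Ioi_ae_eq_Ici, dropLaw_Ioi hc ha]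
    exact ENNReal.ofReal_ne_top

/-- The law at time `t` of the process with unit drift, jump rate `e^y` and downward jumps of law
`Exp(1)`, started from `y`. -/
def transitionLaw (t : ℝ≥0) (y : ℝ) : Measure ℝ :=
  ENNReal.ofReal (Real.exp (-jumpIntensity t y)) • Measure.dirac (y + t) +
    (dropLaw (jumpIntensity t y)).map fun v => y + t - v

instance isProbabilityMeasure_transitionLaw (t : ℝ≥0) (y : ℝ) :
    IsProbabilityMeasure (transitionLaw t y) := by
  constructor
  have hc := jumpIntensity_nonneg t.coe_nonneg y
  rw [transitionLaw, Measure.add_apply, Measure.map_apply (by fun_prop) MeasurableSet.univ,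
    preimage_univ, dropLaw_univ hc, Measure.smul_apply, measure_univ, smul_eq_mul, mul_one,
    ← ENNReal.ofReal_add (Real.exp_pos _).le (by simp [hc])]
  simp

lemma transitionLaw_Ioi (t : ℝ≥0) (y z : ℝ) : transitionLaw t y (Ioi z) =
    (Ioi (z - t)).indicator
      (fun _ => ENNReal.ofReal (Real.exp (-((1 - Real.exp (-t)) * Real.exp z)))) y := by
  have hc := jumpIntensity_nonneg t.coe_nonneg y
  have hp : (fun v => y + t - v) ⁻¹' Ioi z = Iio (y + t - z) := preimage_const_sub_Ioi _ _
  rw [transitionLaw, Measure.add_apply, Measure.map_apply (by fun_prop) measurableSet_Ioi, hp,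
    Measure.smul_apply, Measure.dirac_apply' _ measurableSet_Ioi, smul_eq_mul]
  by_cases h : z - t < y
  · have hz : z < y + t := sub_lt_iff_lt_add.1 h
    have hexp : jumpIntensity t y * Real.exp (-(y + t - z)) =
        (1 - Real.exp (-t)) * Real.exp z := by
      rw [jumpIntensity_eq, mul_assoc, ← Real.exp_add, neg_sub, add_sub_cancel]
    have hle : Real.exp (-(y + t - z)) ≤ 1 := Real.exp_le_one_iff.2 (by linarith)
    rw [dropLaw_Iio hc (sub_pos.2 hz).le, indicator_of_mem (mem_Ioi.2 hz),
      indicator_of_mem (mem_Ioi.2 h), Pi.one_apply, mul_one,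
      ← ENNReal.ofReal_add (Real.exp_pos _).le, hexp, add_sub_cancel]
    rw [sub_nonneg, Real.exp_le_exp, neg_le_neg_iff]
    exact mul_le_of_le_one_right hc hle
  · have hz : y + t ≤ z := le_sub_iff_add_le.1 (not_lt.1 h)
    rw [dropLaw_Iio_of_nonpos _ (sub_nonpos.2 hz), indicator_of_notMem (notMem_Ioi.2 hz),
      indicator_of_notMem (notMem_Ioi.2 (not_lt.1 h)), mul_zero, add_zero]

/-- The semigroup `(P_t)` of transition kernels `y ↦ transitionLaw t y`. -/
def transitionKernel (t : ℝ≥0) : Kernel ℝ ℝ where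
  toFun := transitionLaw t
  measurable' := by
    refine .measure_of_isPiSystem_of_isProbabilityMeasure
      (BorelSpace.measurable_eq.trans (borel_eq_generateFrom_Ioi ℝ)) isPiSystem_Ioi ?_
    rintro _ ⟨z, rfl⟩
    simp_rw [transitionLaw_Ioi]
    exact measurable_const.indicator measurableSet_Ioi

@[simp] lemma transitionKernel_apply (t : ℝ≥0) (y : ℝ) :
    transitionKernel t y = transitionLaw t y := rfl

instance isMarkovKernel_transitionKernel (t : ℝ≥0) : IsMarkovKernel (transitionKernel t) :=
  ⟨fun y => isProbabilityMeasure_transitionLaw t y⟩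

lemma bind_transitionKernel_Ioi (ν : Measure ℝ) (t : ℝ≥0) (z : ℝ) :
    ν.bind (transitionKernel t) (Ioi z) =
      ENNReal.ofReal (Real.exp (-((1 - Real.exp (-t)) * Real.exp z))) * ν (Ioi (z - t)) := by
  rw [Measure.bind_apply measurableSet_Ioi (transitionKernel t).aemeasurable]
  simp_rw [transitionKernel_apply, transitionLaw_Ioi]
  exact lintegral_indicator_const measurableSet_Ioi _

lemma isMarkovSemigroup_transitionKernel : IsMarkovSemigroup transitionKernel where
  markov := inferInstance
  zero := by
    refine Kernel.ext fun y => ext_of_Ioi fun z => ?_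
    rw [transitionKernel_apply, transitionLaw_Ioi, Kernel.id_apply,
      Measure.dirac_apply' _ measurableSet_Ioi]
    simp [indicator]
  add s t := by
    refine Kernel.ext fun y => ext_of_Ioi fun z => ?_
    have hexp : (1 - Real.exp (-t)) * Real.exp z + (1 - Real.exp (-s)) * Real.exp (z - t) =
        (1 - Real.exp (-(s + t))) * Real.exp z := by
      rw [sub_eq_add_neg z, neg_add, Real.exp_add, Real.exp_add]
      ring
    rw [Kernel.comp_apply, bind_transitionKernel_Ioi, transitionKernel_apply,
      transitionKernel_apply, transitionLaw_Ioi, transitionLaw_Ioi, NNReal.coe_add,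
      sub_sub, add_comm (t : ℝ), ← hexp, neg_add, Real.exp_add,
      ENNReal.ofReal_mul (Real.exp_pos _).le]
    exact indicator_const_mul _ _ _ _

lemma invariant_negGumbel (t : ℝ≥0) : Kernel.Invariant (transitionKernel t) negGumbel := by
  refine ext_of_Ioi fun z => ?_
  rw [bind_transitionKernel_Ioi, negGumbel_Ioi, negGumbel_Ioi,
    ← ENNReal.ofReal_mul (Real.exp_pos _).le, ← Real.exp_add, sub_eq_add_neg z, Real.exp_add z]
  congr 2
  ring

lemma invariant_transitionKernel_nsmul {ν : Measure ℝ} {t : ℝ≥0}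
    (h : Kernel.Invariant (transitionKernel t) ν) (n : ℕ) :
    Kernel.Invariant (transitionKernel (n • t)) ν := by
  induction n with
  | zero =>
    rw [zero_smul, isMarkovSemigroup_transitionKernel.zero]
    exact Measure.bind_dirac
  | succ n ih =>
    rw [succ_nsmul, isMarkovSemigroup_transitionKernel.add]
    exact h.comp ih

lemma eq_negGumbel_of_invariant {ν : Measure ℝ} [IsProbabilityMeasure ν] {t : ℝ≥0} (ht : 0 < t)
    (h : Kernel.Invariant (transitionKernel t) ν) : ν = negGumbel := by
  refine ext_of_Ioi fun z => ?_
  have htail (n : ℕ) : ENNReal.ofReal (Real.exp (-((1 - Real.exp (-(n • t : ℝ≥0))) * Real.exp z)))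
      * ν (Ioi (z - (n • t : ℝ≥0))) = ν (Ioi z) := by
    rw [← bind_transitionKernel_Ioi, (invariant_transitionKernel_nsmul h n).def]
  have htop : Tendsto (fun n : ℕ => ((n • t : ℝ≥0) : ℝ)) atTop atTop := by
    simpa using tendsto_natCast_atTop_atTop.atTop_mul_const (NNReal.coe_pos.2 ht)
  have hexp : Tendsto (fun n : ℕ => ENNReal.ofReal
      (Real.exp (-((1 - Real.exp (-(n • t : ℝ≥0))) * Real.exp z)))) atTop
      (𝓝 (negGumbel (Ioi z))) := by
    have h0 := Real.tendsto_exp_neg_atTop_nhds_zero.comp htop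
    rw [negGumbel_Ioi]
    refine ENNReal.tendsto_ofReal ((Real.continuous_exp.tendsto _).comp ?_)
    simpa [Function.comp_def] using ((h0.const_sub 1).mul_const (Real.exp z)).neg
  have hone : Tendsto (fun n : ℕ => ν (Ioi (z - (n • t : ℝ≥0)))) atTop (𝓝 1) := by
    rw [← measure_univ (μ := ν)]
    refine (tendsto_measure_Ioi_atBot ν).comp ?_
    simpa only [sub_eq_add_neg, Function.comp_apply] using
      tendsto_atBot_add_const_left atTop z (tendsto_neg_atTop_atBot.comp htop)
  have hlim := ENNReal.Tendsto.mul hexp (Or.inr ENNReal.one_ne_top) hone (Or.inl one_ne_zero)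
  rw [mul_one] at hlim
  exact tendsto_nhds_unique (tendsto_const_nhds.congr fun n => (htail n).symm) hlim

end TransitionKernel

/-! ### The generator -/

section Generator

lemma integrable_dropLaw {g : ℝ → ℝ} (hg : Integrable g (expMeasure 1)) {c : ℝ} (hc : 0 ≤ c) :
    Integrable g (dropLaw c) := by
  rw [dropLaw, integrable_withDensity_iff (by fun_prop) (by simp)]
  refine (hg.mul_const c).mono
    (hg.aestronglyMeasurable.mul (Measurable.aestronglyMeasurable (by fun_prop)))
    (ae_of_all _ fun v => ?_)
  have hexp : Real.exp (-(c * Real.exp (-v))) ≤ 1 :=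
    Real.exp_le_one_iff.2 (neg_nonpos.2 (by positivity))
  have hnonneg : 0 ≤ c * Real.exp (-(c * Real.exp (-v))) := by positivity
  rw [ENNReal.toReal_ofReal hnonneg, norm_mul (g v), norm_mul (g v) c, Real.norm_of_nonneg hnonneg,
    Real.norm_of_nonneg hc]
  exact mul_le_mul_of_nonneg_left (mul_le_of_le_one_right hc hexp) (norm_nonneg (g v))

lemma integral_dropLaw (g : ℝ → ℝ) {c : ℝ} (hc : 0 ≤ c) :
    ∫ v, g v ∂(dropLaw c) =
      ∫ v in Ioi (0 : ℝ), g v * (c * Real.exp (-v)) * Real.exp (-(c * Real.exp (-v))) := by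
  rw [dropLaw, integral_withDensity_eq_integral_toReal_smul (by fun_prop) (by simp),
    integral_expMeasure_one]
  refine integral_congr_ae (ae_of_all _ fun v => ?_)
  dsimp only
  rw [smul_eq_mul, ENNReal.toReal_ofReal (by positivity)]
  ring

lemma setIntegral_Ioi_zero_eq_setIntegral_Iio {E : Type*} [NormedAddCommGroup E] [NormedSpace ℝ E]
    (g : ℝ → E) (w : ℝ) : ∫ v in Ioi 0, g v = ∫ z in Iio w, g (w - z) := by
  have h := (Measure.measurePreserving_sub_left volume w).setIntegral_preimage_emb
    (measurableEmbedding_subLeft w) g (Ioi 0)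
  rw [← h, preimage_const_sub_Ioi, sub_zero]

variable {f : ℝ → ℝ}

lemma integral_exp_neg_mul_comp_sub (f : ℝ → ℝ) (y : ℝ) :
    ∫ u in Ioi (0 : ℝ), f (y - u) * Real.exp (-u) =
      Real.exp (-y) * ∫ z in Iio y, f z * Real.exp z := by
  rw [setIntegral_Ioi_zero_eq_setIntegral_Iio _ y, ← integral_const_mul]
  refine integral_congr_ae (ae_of_all _ fun z => ?_)
  dsimp only
  rw [sub_sub_cancel, neg_sub, sub_eq_neg_add, Real.exp_add]
  ring

lemma integrableOn_Iio_mul_exp {y : ℝ}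
    (hf : IntegrableOn (fun u => f (y - u) * Real.exp (-u)) (Ioi 0)) :
    IntegrableOn (fun z => f z * Real.exp z) (Iio y) := by
  have h := ((Measure.measurePreserving_sub_left volume y).integrableOn_comp_preimage
    (measurableEmbedding_subLeft y)).2 hf
  rw [preimage_const_sub_Ioi, sub_zero] at h
  have hcancel : Real.exp y * Real.exp (-y) = 1 := by
    rw [← Real.exp_add, add_neg_cancel, Real.exp_zero]
  refine (h.const_mul (Real.exp y)).congr (ae_of_all _ fun z => ?_)
  dsimp only [Function.comp]
  rw [sub_sub_cancel, neg_sub, sub_eq_neg_add, Real.exp_add]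
  linear_combination f z * Real.exp z * hcancel

lemma integrable_map_sub_left_dropLaw {w : ℝ}
    (hf : IntegrableOn (fun u => f (w - u) * Real.exp (-u)) (Ioi 0)) {c : ℝ} (hc : 0 ≤ c) :
    Integrable f ((dropLaw c).map fun v => w - v) :=
  (measurableEmbedding_subLeft w).integrable_map_iff.2
    (integrable_dropLaw (integrable_expMeasure_one_iff.2 hf) hc)

lemma integrable_smul_dirac (f : ℝ → ℝ) (r w : ℝ) :
    Integrable f (ENNReal.ofReal r • Measure.dirac w) :=
  (integrable_dirac (by simp)).smul_measure ENNReal.ofReal_ne_top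

variable {t : ℝ≥0} {y : ℝ}

lemma integrable_transitionLaw
    (hf : IntegrableOn (fun u => f (y + t - u) * Real.exp (-u)) (Ioi 0)) :
    Integrable f (transitionLaw t y) :=
  (integrable_smul_dirac f _ _).add_measure
    (integrable_map_sub_left_dropLaw hf (jumpIntensity_nonneg t.coe_nonneg y))

lemma integral_transitionLaw
    (hf : IntegrableOn (fun u => f (y + t - u) * Real.exp (-u)) (Ioi 0)) :
    ∫ z, f z ∂(transitionLaw t y) = Real.exp (-jumpIntensity t y) * f (y + t) +
      (1 - Real.exp (-t)) * ∫ z in Iio (y + t),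
        f z * Real.exp z * Real.exp (-((1 - Real.exp (-t)) * Real.exp z)) := by
  have hc := jumpIntensity_nonneg t.coe_nonneg y
  have hexp (z : ℝ) : jumpIntensity t y * Real.exp (-(y + t - z)) =
      (1 - Real.exp (-t)) * Real.exp z := by
    rw [jumpIntensity_eq, mul_assoc, ← Real.exp_add, neg_sub, add_sub_cancel]
  rw [transitionLaw, integral_add_measure (integrable_smul_dirac f _ _)
    (integrable_map_sub_left_dropLaw hf hc), integral_smul_measure, integral_dirac,
    (measurableEmbedding_subLeft (y + (t : ℝ))).integral_map,
    integral_dropLaw _ hc, ENNReal.toReal_ofReal (Real.exp_pos _).le, smul_eq_mul,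
    setIntegral_Ioi_zero_eq_setIntegral_Iio _ (y + t), ← integral_const_mul]
  congr 1
  refine integral_congr_ae (ae_of_all _ fun z => ?_)
  dsimp only
  rw [sub_sub_cancel, hexp]
  ring

lemma tendsto_setIntegral_Iio_mul {ι : Type*} {l : Filter ι} [l.IsCountablyGenerated]
    {g : ℝ → ℝ} {φ : ι → ℝ → ℝ} {ψ : ℝ → ℝ} {b : ι → ℝ} {β B : ℝ} (hg : IntegrableOn g (Iio B))
    (hφm : ∀ i, Measurable (φ i)) (hφ : ∀ i z, |φ i z| ≤ 1)
    (hφψ : ∀ z, Tendsto (φ · z) l (𝓝 (ψ z))) (hb : Tendsto b l (𝓝 β)) (hβ : β < B) :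
    Tendsto (fun i => ∫ z in Iio (b i), g z * φ i z) l (𝓝 (∫ z in Iio β, g z * ψ z)) := by
  have hbB : ∀ᶠ i in l, Iio (b i) ⊆ Iio B :=
    (hb.eventually_le_const hβ).mono fun i hi => Iio_subset_Iio hi
  simp_rw [← integral_indicator measurableSet_Iio]
  refine tendsto_integral_filter_of_dominated_convergence ((Iio B).indicator fun z => ‖g z‖) ?_ ?_
    ((integrable_indicator_iff measurableSet_Iio).2 hg.norm) ?_
  · filter_upwards [hbB] with i hi
    exact (aestronglyMeasurable_indicator_iff measurableSet_Iio).2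
      ((hg.mono_set hi).aestronglyMeasurable.mul (hφm i).aestronglyMeasurable)
  · filter_upwards [hbB] with i hi
    refine ae_of_all _ fun z => ?_
    rw [norm_indicator_eq_indicator_norm]
    refine (indicator_le_indicator ?_).trans
      (indicator_le_indicator_of_subset hi (fun _ => norm_nonneg _) z)
    rw [norm_mul]
    exact mul_le_of_le_one_right (norm_nonneg _) (hφ i z)
  · filter_upwards [Measure.ae_ne volume β] with z hz
    rcases hz.lt_or_gt with hz | hz
    · rw [indicator_of_mem (mem_Iio.2 hz)]
      refine ((hφψ z).const_mul (g z)).congr' ?_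
      filter_upwards [hb.eventually_const_lt hz] with i hi
      rw [indicator_of_mem (mem_Iio.2 hi)]
    · rw [indicator_of_notMem (notMem_Iio.2 hz.le)]
      refine tendsto_const_nhds.congr' ?_
      filter_upwards [hb.eventually_lt_const hz] with i hi
      rw [indicator_of_notMem (notMem_Iio.2 hi.le)]

lemma tendsto_coe_nhdsGT_zero : Tendsto ((↑) : ℝ≥0 → ℝ) (𝓝[>] 0) (𝓝[≠] 0) :=
  tendsto_nhdsWithin_iff.2
    ⟨(NNReal.continuous_coe.tendsto' 0 0 NNReal.coe_zero).mono_left nhdsWithin_le_nhds,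
      eventually_nhdsWithin_of_forall fun _ ht => (NNReal.coe_pos.2 ht).ne'⟩

lemma generator_eq (hf : IntegrableOn (fun u => f (y - u) * Real.exp (-u)) (Ioi 0)) :
    generator f y = deriv f y - Real.exp y * f y + ∫ z in Iio y, f z * Real.exp z := by
  have hexp : IntegrableOn (fun u : ℝ => f y * Real.exp (-u)) (Ioi 0) :=
    (integrableOn_exp_neg_Ioi 0).const_mul (f y)
  have hcancel : Real.exp y * Real.exp (-y) = 1 := by
    rw [← Real.exp_add, add_neg_cancel, Real.exp_zero]
  simp_rw [generator, sub_mul]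
  rw [integral_sub hf hexp, integral_const_mul, integral_exp_neg_Ioi_zero,
    integral_exp_neg_mul_comp_sub]
  linear_combination (∫ z in Iio y, f z * Real.exp z) * hcancel

lemma hasDerivAt_exp_neg_jumpIntensity_mul (hf : DifferentiableAt ℝ f y) :
    HasDerivAt (fun s => Real.exp (-jumpIntensity s y) * f (y + s))
      (deriv f y - Real.exp y * f y) 0 := by
  have hJ : HasDerivAt (fun s => -jumpIntensity s y) (-Real.exp y) 0 := by
    simpa using! (((Real.hasDerivAt_exp 0).sub_const 1).mul_const (Real.exp y)).neg
  have hfy : HasDerivAt (fun s => f (y + s)) (deriv f y) 0 := by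
    refine HasDerivAt.comp_const_add y 0 ?_
    rw [add_zero]
    exact hf.hasDerivAt
  convert! hJ.exp.mul hfy using 1
  simp only [jumpIntensity, Real.exp_zero, sub_self, zero_mul, neg_zero, add_zero]
  ring

theorem tendsto_generator
    (hfi : ∀ y, IntegrableOn (fun u => f (y - u) * Real.exp (-u)) (Ioi 0))
    (hf : DifferentiableAt ℝ f y) :
    Tendsto (fun t : ℝ≥0 => ((∫ z, f z ∂(transitionLaw t y)) - f y) / (t : ℝ)) (𝓝[>] 0)
      (𝓝 (generator f y)) := by
  have hcoe : Tendsto ((↑) : ℝ≥0 → ℝ) (𝓝[>] 0) (𝓝 0) :=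
    tendsto_coe_nhdsGT_zero.mono_right nhdsWithin_le_nhds
  have hnojump := (hasDerivAt_iff_tendsto_slope_zero.1
    (hasDerivAt_exp_neg_jumpIntensity_mul hf)).comp tendsto_coe_nhdsGT_zero
  have hrate : HasDerivAt (fun s : ℝ => 1 - Real.exp (-s)) 1 0 := by
    simpa using! ((hasDerivAt_neg (0 : ℝ)).exp.const_sub 1)
  have hjump := (hasDerivAt_iff_tendsto_slope_zero.1 hrate).comp tendsto_coe_nhdsGT_zero
  have hint : Tendsto (fun t : ℝ≥0 => ∫ z in Iio (y + t),
      f z * Real.exp z * Real.exp (-((1 - Real.exp (-t)) * Real.exp z))) (𝓝[>] 0)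
      (𝓝 (∫ z in Iio y, f z * Real.exp z)) := by
    have hlim := tendsto_setIntegral_Iio_mul (ψ := fun _ => 1)
      (φ := fun (t : ℝ≥0) z => Real.exp (-((1 - Real.exp (-t)) * Real.exp z)))
      (integrableOn_Iio_mul_exp (hfi (y + 1))) (fun t => by fun_prop) (fun t z => ?_) (fun z => ?_)
      (by simpa using hcoe.const_add y) (lt_add_one y)
    · simpa only [mul_one] using hlim
    · rw [Real.abs_exp, Real.exp_le_one_iff, neg_nonpos]
      exact mul_nonneg (sub_nonneg.2 (by simp)) (Real.exp_pos z).le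
    · have hcont : Continuous fun s : ℝ => Real.exp (-((1 - Real.exp (-s)) * Real.exp z)) := by
        fun_prop
      simpa using! (hcont.tendsto' 0 1 (by simp)).comp hcoe
  rw [generator_eq (hfi y), ← one_mul (∫ z in Iio y, _)]
  refine (hnojump.add (hjump.mul hint)).congr fun t => ?_
  rw [integral_transitionLaw (hfi _)]
  simp only [Function.comp, smul_eq_mul, jumpIntensity, zero_add, Real.exp_zero, sub_self,
    zero_mul, neg_zero, add_zero, one_mul, sub_zero]
  ring

end Generator

/-! ### Paths with unit drift and isolated jumps -/

section DriftJumpPath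

variable {Ω : Type*}

/-- The path `X · ω` is right-continuous and has slope one away from isolated jumps. -/
def IsDriftJumpPath (X : ℝ → Ω → ℝ) (ω : Ω) : Prop :=
  ∀ r, (∀ᶠ q in 𝓝[>] r, X q ω - q = X r ω - r) ∧ ∃ l, ∀ᶠ q in 𝓝[<] r, X q ω - q = l

/-- The amount by which the increment of `X` over `(a, b]` falls short of a unit drift. -/
def drop (X : ℝ → Ω → ℝ) (a b : ℝ) (ω : Ω) : ℝ := X a ω + (b - a) - X b ω

/-- On `(a, b]`, the path `X · ω` is the sum of a unit drift and finitely many jumps. -/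
def JumpEquation (X : ℝ → Ω → ℝ) (ω : Ω) (a b : ℝ) : Prop :=
  (jumpTimes X ω a b).Finite ∧ drop X a b ω = ∑ᶠ r ∈ jumpTimes X ω a b, jumpSize X ω r

variable {X : ℝ → Ω → ℝ} {ω : Ω} {a b c s t : ℝ} {A : Set ℝ}

lemma jumpTimes_self (a : ℝ) : jumpTimes X ω a a = ∅ := by
  simp only [jumpTimes, Ioc_self, mem_empty_iff_false, false_and, ofPred_false]

lemma jumpTimes_union (hab : a ≤ b) (hbc : b ≤ c) :
    jumpTimes X ω a b ∪ jumpTimes X ω b c = jumpTimes X ω a c := by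
  ext r
  simp only [jumpTimes, mem_ofPred_eq, mem_union, ← or_and_right, ← Ioc_union_Ioc_eq_Ioc hab hbc]

lemma disjoint_jumpTimes (a b c : ℝ) : Disjoint (jumpTimes X ω a b) (jumpTimes X ω b c) :=
  (Ioc_disjoint_Ioc_of_le le_rfl).mono (fun _ h => h.1) (fun _ h => h.1)

lemma JumpEquation.refl (a : ℝ) : JumpEquation X ω a a := by
  simp [JumpEquation, jumpTimes_self, drop]

lemma JumpEquation.trans (hab : a ≤ b) (hbc : b ≤ c) (h₁ : JumpEquation X ω a b)
    (h₂ : JumpEquation X ω b c) : JumpEquation X ω a c := by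
  rw [JumpEquation, ← jumpTimes_union hab hbc,
    finsum_mem_union (disjoint_jumpTimes a b c) h₁.1 h₂.1, ← h₁.2, ← h₂.2]
  exact ⟨h₁.1.union h₂.1, by simp only [drop]; ring⟩

lemma jumpCount_self (a : ℝ) (A : Set ℝ) : jumpCount X a a A ω = 0 := by
  simp [jumpCount, jumpTimes_self]

lemma jumpCount_add (hab : a ≤ b) (hbc : b ≤ c) (A : Set ℝ) :
    jumpCount X a b A ω + jumpCount X b c A ω = jumpCount X a c A ω := by
  simp only [jumpCount]
  rw [← jumpTimes_union hab hbc, ← ENat.toENNReal_add, ← encard_union_eq]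
  · congr 2
    ext r
    simp [or_and_right]
  · exact (disjoint_jumpTimes a b c).mono (fun _ h => h.1) (fun _ h => h.1)

lemma sum_jumpCount {τ : ℕ → ℝ} (hτ : Monotone τ) (A : Set ℝ) (n : ℕ) :
    ∑ i ∈ Finset.range n, jumpCount X (τ i) (τ (i + 1)) A ω = jumpCount X (τ 0) (τ n) A ω := by
  induction n with
  | zero => simp [jumpCount_self]
  | succ n ih =>
    rw [Finset.sum_range_succ, ih, jumpCount_add (hτ (Nat.zero_le n)) (hτ n.le_succ)]

lemma jumpCount_diff_zero (s t : ℝ) (A : Set ℝ) :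
    jumpCount X s t (A \ {0}) ω = jumpCount X s t A ω := by
  have h : {r ∈ jumpTimes X ω s t | jumpSize X ω r ∈ A \ {0}} =
      {r ∈ jumpTimes X ω s t | jumpSize X ω r ∈ A} := by
    ext r
    simp only [jumpTimes, mem_ofPred_eq, Set.mem_sdiff, mem_singleton_iff]
    tauto
  rw [jumpCount, h, jumpCount]

lemma JumpEquation.jumpCount_eq_indicator_drop (h : JumpEquation X ω a b)
    (hsub : (jumpTimes X ω a b).Subsingleton) (hA : 0 ∉ A) :
    jumpCount X a b A ω = A.indicator 1 (drop X a b ω) := by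
  rw [h.2, jumpCount]
  rcases hsub.eq_empty_or_singleton with he | ⟨r, hr⟩
  · simp [he, hA]
  · rw [hr, finsum_mem_singleton]
    by_cases hmem : jumpSize X ω r ∈ A
    · have hset : {q ∈ ({r} : Set ℝ) | jumpSize X ω q ∈ A} = {r} := by
        ext q
        simp +contextual [hmem]
      rw [hset, indicator_of_mem hmem, encard_singleton, ENat.toENNReal_one, Pi.one_apply]
    · have hset : {q ∈ ({r} : Set ℝ) | jumpSize X ω q ∈ A} = ∅ := by
        ext q
        simp +contextual [hmem]
      rw [hset, indicator_of_notMem hmem, encard_empty, ENat.toENNReal_zero]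

lemma JumpEquation.indicator_drop_le_jumpCount (h : JumpEquation X ω a b) (hA : 0 ∉ A) :
    A.indicator (1 : ℝ → ℝ≥0∞) (drop X a b ω) ≤ jumpCount X a b univ ω := by
  rcases eq_empty_or_nonempty (jumpTimes X ω a b) with he | hne
  · simp [h.2, he, hA]
  · refine (indicator_le_self _ _ _).trans ?_
    simpa [jumpCount] using ENat.toENNReal_le.2 (one_le_encard_iff_nonempty.2 hne)

lemma jumpSize_eq_of_eventually {r l : ℝ} (h : ∀ᶠ q in 𝓝[<] r, X q ω - q = l) :
    jumpSize X ω r = l + r - X r ω := by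
  have hlim : Tendsto (fun q : ℝ => l + q) (𝓝[<] r) (𝓝 (l + r)) :=
    ((continuous_const.add continuous_id).tendsto r).mono_left nhdsWithin_le_nhds
  rw [jumpSize, leftLim_eq_of_tendsto (hlim.congr' (h.mono fun q hq => by linarith))]

lemma jumpSize_eq_zero_of_forall_Ioo {r l : ℝ} (h : ∀ q ∈ Ioo a b, X q ω - q = l)
    (hr : r ∈ Ioo a b) : jumpSize X ω r = 0 := by
  have hleft : ∀ᶠ q in 𝓝[<] r, X q ω - q = l := by
    filter_upwards [Ioo_mem_nhdsLT hr.1] with q hq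
    exact h q ⟨hq.1, hq.2.trans hr.2⟩
  linarith [jumpSize_eq_of_eventually hleft, h r hr]

namespace IsDriftJumpPath

lemma cadlag (h : IsDriftJumpPath X ω) (t : ℝ) :
    ContinuousWithinAt (fun s => X s ω) (Ici t) t ∧
      ∃ l, Tendsto (fun s => X s ω) (𝓝[<] t) (𝓝 l) := by
  obtain ⟨hr, l, hl⟩ := h t
  have hline (c : ℝ) : Tendsto (fun q : ℝ => c + q) (𝓝 t) (𝓝 (c + t)) :=
    (continuous_const.add continuous_id).tendsto t
  constructor
  · have h₁ := (hline (X t ω - t)).mono_left (nhdsWithin_le_nhds (s := Ioi t))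
    rw [sub_add_cancel] at h₁
    exact continuousWithinAt_Ioi_iff_Ici.1 (h₁.congr' (hr.mono fun q hq => by linarith))
  · exact ⟨l + t, ((hline l).mono_left nhdsWithin_le_nhds).congr'
      (hl.mono fun q hq => by linarith)⟩

lemma exists_forall_Ioo_and_Ico (h : IsDriftJumpPath X ω) (r : ℝ) :
    ∃ ε > 0, ∃ l, (∀ q ∈ Ioo (r - ε) r, X q ω - q = l) ∧
      ∀ q ∈ Ico r (r + ε), X q ω - q = X r ω - r := by
  obtain ⟨hr, l, hl⟩ := h r
  obtain ⟨ε, hε, hball⟩ := Metric.eventually_nhds_iff.1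
    ((eventually_nhdsWithin_iff.1 hl).and (eventually_nhdsWithin_iff.1 hr))
  refine ⟨ε, hε, l, fun q hq => (hball ?_).1 hq.2, fun q hq => ?_⟩
  · rw [Real.dist_eq, abs_lt]
    exact ⟨by linarith [hq.1], by linarith [hq.2]⟩
  · rcases hq.1.eq_or_lt with rfl | hlt
    · rfl
    · refine (hball ?_).2 hlt
      rw [Real.dist_eq, abs_lt]
      exact ⟨by linarith, by linarith [hq.2]⟩

lemma exists_subsingleton_jumpTimes_near (h : IsDriftJumpPath X ω) (r : ℝ) :
    ∃ ε > 0, ∀ a b, a ≤ b → r - ε < a → b < r + ε →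
      (jumpTimes X ω a b).Subsingleton ∧ JumpEquation X ω a b := by
  obtain ⟨ε, hε, l, hleft, hright⟩ := h.exists_forall_Ioo_and_Ico r
  refine ⟨ε, hε, fun a b hab ha hb => ?_⟩
  have hsub : jumpTimes X ω a b ⊆ {r} := by
    rintro q ⟨⟨haq, hqb⟩, hq⟩
    by_contra hqr
    rcases lt_or_gt_of_ne hqr with hlt | hgt
    · exact hq (jumpSize_eq_zero_of_forall_Ioo hleft ⟨ha.trans haq, hlt⟩)
    · exact hq (jumpSize_eq_zero_of_forall_Ioo (fun p hp => hright p ⟨hp.1.le, hp.2⟩)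
        ⟨hgt, hqb.trans_lt hb⟩)
  refine ⟨subsingleton_singleton.anti hsub, (finite_singleton r).subset hsub, ?_⟩
  by_cases hr : r ∈ Ioc a b
  · have hsum : ∑ᶠ q ∈ jumpTimes X ω a b, jumpSize X ω q = jumpSize X ω r := by
      rw [← finsum_mem_singleton (f := jumpSize X ω) (a := r), ← finsum_mem_inter_support _ {r}]
      congr! 3 with q
      exact ⟨fun hq => ⟨hsub hq, hq.2⟩, fun hq => ⟨hq.1 ▸ hr, hq.2⟩⟩
    have hjump : jumpSize X ω r = l + r - X r ω := jumpSize_eq_of_eventually <| by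
      filter_upwards [Ioo_mem_nhdsLT (sub_lt_self r hε)] with q hq using hleft q hq
    rw [hsum, hjump, drop]
    linarith [hleft a ⟨ha, hr.1⟩, hright b ⟨hr.2, hb⟩]
  · have hempty : jumpTimes X ω a b = ∅ :=
      subset_empty_iff.1 fun q hq => hr (hsub hq ▸ hq.1)
    rw [hempty, finsum_mem_empty, drop]
    rcases le_or_gt r a with hra | har
    · linarith [hright a ⟨hra, hab.trans_lt hb⟩, hright b ⟨hra.trans hab, hb⟩]
    · have hbr : b < r := lt_of_not_ge fun hrb => hr ⟨har, hrb⟩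
      linarith [hleft a ⟨ha, har⟩, hleft b ⟨ha.trans_le hab, hbr⟩]

lemma exists_subsingleton_jumpTimes (h : IsDriftJumpPath X ω) (s t : ℝ) :
    ∃ δ > 0, ∀ a b, s ≤ a → a ≤ b → b ≤ t → b - a < δ →
      (jumpTimes X ω a b).Subsingleton ∧ JumpEquation X ω a b := by
  choose ε hε hJ using h.exists_subsingleton_jumpTimes_near
  obtain ⟨δ, hδ, hball⟩ := lebesgue_number_lemma_of_metric (isCompact_Icc (a := s) (b := t))
    (c := fun r => Metric.ball r (ε r)) (fun r => Metric.isOpen_ball)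
    (fun r _ => mem_iUnion.2 ⟨r, Metric.mem_ball_self (hε r)⟩)
  refine ⟨δ, hδ, fun a b hsa hab hbt hlt => ?_⟩
  obtain ⟨r, hr⟩ := hball a ⟨hsa, hab.trans hbt⟩
  have ha := hr (Metric.mem_ball_self hδ)
  have hb : b ∈ Metric.ball r (ε r) := by
    refine hr ?_
    rwa [Metric.mem_ball, Real.dist_eq, abs_of_nonneg (sub_nonneg.2 hab)]
  rw [Metric.mem_ball, Real.dist_eq, abs_lt] at ha hb
  exact hJ r a b hab (by linarith) (by linarith)

end IsDriftJumpPath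

/-- The points dividing `[s, t]` into `n + 1` intervals of equal length. -/
def gridPoint (s t : ℝ) (n i : ℕ) : ℝ := s + i * ((t - s) / (n + 1))

lemma gridPoint_zero (s t : ℝ) (n : ℕ) : gridPoint s t n 0 = s := by simp [gridPoint]

lemma gridPoint_last (s t : ℝ) (n : ℕ) : gridPoint s t n (n + 1) = t := by
  rw [gridPoint]; push_cast; field_simp; ring

lemma gridPoint_succ (s t : ℝ) (n i : ℕ) :
    gridPoint s t n (i + 1) = gridPoint s t n i + (t - s) / (n + 1) := by
  rw [gridPoint, gridPoint]; push_cast; ring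

lemma gridPoint_succ_sub (s t : ℝ) (n i : ℕ) :
    gridPoint s t n (i + 1) - gridPoint s t n i = (t - s) / (n + 1) := by
  rw [gridPoint_succ, add_sub_cancel_left]

lemma mesh_nonneg (hst : s ≤ t) (n : ℕ) : 0 ≤ (t - s) / ((n : ℝ) + 1) :=
  div_nonneg (sub_nonneg.2 hst) (by positivity)

lemma tendsto_mesh (s t : ℝ) : Tendsto (fun n : ℕ => (t - s) / ((n : ℝ) + 1)) atTop (𝓝 0) :=
  tendsto_const_nhds.div_atTop
    (tendsto_atTop_add_const_right _ 1 (tendsto_natCast_atTop_atTop (R := ℝ)))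

lemma monotone_gridPoint (hst : s ≤ t) (n : ℕ) : Monotone (gridPoint s t n) :=
  monotone_nat_of_le_succ fun i => by
    rw [gridPoint_succ]
    exact le_add_of_nonneg_right (mesh_nonneg hst n)

lemma le_gridPoint (hst : s ≤ t) (n i : ℕ) : s ≤ gridPoint s t n i :=
  (gridPoint_zero s t n).symm.le.trans (monotone_gridPoint hst n (Nat.zero_le i))

lemma gridPoint_le (hst : s ≤ t) {n i : ℕ} (hi : i ≤ n + 1) : gridPoint s t n i ≤ t :=
  (monotone_gridPoint hst n hi).trans (gridPoint_last s t n).le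

lemma sum_grid_jumpCount (hst : s ≤ t) (A : Set ℝ) (n : ℕ) :
    ∑ i ∈ Finset.range (n + 1),
      jumpCount X (gridPoint s t n i) (gridPoint s t n (i + 1)) A ω = jumpCount X s t A ω := by
  rw [sum_jumpCount (monotone_gridPoint hst n), gridPoint_zero, gridPoint_last]

/-- The number of intervals of the grid of mesh `(t - s) / (n + 1)` on `[s, t]` over which the drop
of `X` lies in `A`. It approximates `jumpCount X s t A`. -/
def gridDropCount (X : ℝ → Ω → ℝ) (s t : ℝ) (A : Set ℝ) (n : ℕ) (ω : Ω) : ℝ≥0∞ :=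
  ∑ i ∈ Finset.range (n + 1),
    A.indicator 1 (drop X (gridPoint s t n i) (gridPoint s t n (i + 1)) ω)

namespace IsDriftJumpPath

lemma eventually_subsingleton_jumpTimes_grid (h : IsDriftJumpPath X ω) (hst : s ≤ t) :
    ∀ᶠ n in atTop, ∀ i ≤ n,
      (jumpTimes X ω (gridPoint s t n i) (gridPoint s t n (i + 1))).Subsingleton ∧
        JumpEquation X ω (gridPoint s t n i) (gridPoint s t n (i + 1)) := by
  obtain ⟨δ, hδ, hJ⟩ := h.exists_subsingleton_jumpTimes s t
  filter_upwards [(tendsto_mesh s t).eventually (gt_mem_nhds hδ)] with n hn i hi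
  exact hJ _ _ (le_gridPoint hst n i) (monotone_gridPoint hst n i.le_succ)
    (gridPoint_le hst (by omega)) (by rwa [gridPoint_succ_sub])

lemma jumpEquation (h : IsDriftJumpPath X ω) (hst : s ≤ t) : JumpEquation X ω s t := by
  obtain ⟨n, hn⟩ := (h.eventually_subsingleton_jumpTimes_grid hst).exists
  have hgrid : ∀ i ≤ n + 1, JumpEquation X ω s (gridPoint s t n i) := by
    intro i
    induction i with
    | zero => intro; rw [gridPoint_zero]; exact .refl s
    | succ i ih =>
      exact fun hi => (ih (by omega)).trans (le_gridPoint hst n i)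
        (monotone_gridPoint hst n i.le_succ) (hn i (by omega)).2
  simpa only [gridPoint_last] using hgrid (n + 1) le_rfl

lemma gridDropCount_le (h : IsDriftJumpPath X ω) (hst : s ≤ t) (hA : 0 ∉ A) (n : ℕ) :
    gridDropCount X s t A n ω ≤ jumpCount X s t univ ω := by
  rw [← sum_grid_jumpCount hst univ n]
  exact Finset.sum_le_sum fun i _ =>
    (h.jumpEquation (monotone_gridPoint hst n i.le_succ)).indicator_drop_le_jumpCount hA

lemma tendsto_gridDropCount (h : IsDriftJumpPath X ω) (hst : s ≤ t) (hA : 0 ∉ A) :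
    Tendsto (fun n => gridDropCount X s t A n ω) atTop (𝓝 (jumpCount X s t A ω)) := by
  refine tendsto_const_nhds.congr' ?_
  filter_upwards [h.eventually_subsingleton_jumpTimes_grid hst] with n hn
  rw [← sum_grid_jumpCount hst A n]
  refine Finset.sum_congr rfl fun i hi => ?_
  have hi' := hn i (Nat.lt_succ_iff.1 (Finset.mem_range.1 hi))
  exact hi'.2.jumpCount_eq_indicator_drop hi'.1 hA

end IsDriftJumpPath

end DriftJumpPath

/-! ### The cumulative jump intensity along a path -/

section CumulativeIntensity

lemma continuous_jumpIntensity (y : ℝ) : Continuous fun t => jumpIntensity t y :=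
  (Real.continuous_exp.sub continuous_const).mul continuous_const

lemma jumpIntensity_zero (y : ℝ) : jumpIntensity 0 y = 0 := by simp [jumpIntensity]

lemma monotone_jumpIntensity {t : ℝ} (ht : 0 ≤ t) : Monotone (jumpIntensity t) := fun _ _ hyz =>
  mul_le_mul_of_nonneg_left (Real.exp_le_exp.2 hyz) (sub_nonneg.2 (Real.one_le_exp ht))

lemma integral_exp_const_add (c a b : ℝ) :
    ∫ r in a..b, Real.exp (c + r) = jumpIntensity (b - a) (c + a) := by
  rw [intervalIntegral.integral_comp_add_left Real.exp, integral_exp, jumpIntensity, sub_mul,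
    one_mul, ← Real.exp_add]
  congr 2
  ring

lemma jumpIntensity_add_gridPoint (s t y : ℝ) (n i : ℕ) :
    jumpIntensity ((t - s) / (n + 1)) (y + (gridPoint s t n i - s)) =
      Real.exp (y + (gridPoint s t n (i + 1) - s)) - Real.exp (y + (gridPoint s t n i - s)) := by
  rw [jumpIntensity, sub_mul, one_mul, ← Real.exp_add, gridPoint_succ]
  congr 2
  ring

/-- The cumulative jump intensity, over the subdivision of `[s, t]` into `n + 1` intervals, of the
path that restarts at each dividing point from its value there and follows the drift. -/
def gridIntensity (x : ℝ → ℝ) (s t : ℝ) (n : ℕ) : ℝ :=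
  ∑ i ∈ Finset.range (n + 1), jumpIntensity ((t - s) / (n + 1)) (x (gridPoint s t n i))

variable {x : ℝ → ℝ} {s t a b : ℝ}

lemma intervalIntegrable_exp_of_antitone (hx : Antitone fun r => x r - r) (a b : ℝ) :
    IntervalIntegrable (fun r => Real.exp (x r)) volume a b := by
  have hanti : Antitone fun r => Real.exp (x r - r) := fun p q h => Real.exp_le_exp.2 (hx h)
  refine ((hanti.intervalIntegrable (μ := volume) (a := a) (b := b)).mul_continuousOn
    Real.continuous_exp.continuousOn).congr fun r _ => ?_
  rw [← Real.exp_add, sub_add_cancel]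

lemma integral_exp_le_jumpIntensity (hx : Antitone fun r => x r - r) (hab : a ≤ b) :
    ∫ r in a..b, Real.exp (x r) ≤ jumpIntensity (b - a) (x a) := by
  rw [← sub_add_cancel (x a) a, ← integral_exp_const_add]
  refine intervalIntegral.integral_mono_on hab (intervalIntegrable_exp_of_antitone hx a b)
    (Continuous.intervalIntegrable (by fun_prop) a b) fun r hr => Real.exp_le_exp.2 ?_
  linarith [hx hr.1]

lemma jumpIntensity_le_integral_exp (hx : Antitone fun r => x r - r) (hab : a ≤ b) :
    jumpIntensity (b - a) (x b) ≤ Real.exp (b - a) * ∫ r in a..b, Real.exp (x r) := by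
  have hdrift : ∫ r in a..b, Real.exp (x b - b + r) ≤ ∫ r in a..b, Real.exp (x r) :=
    intervalIntegral.integral_mono_on hab (Continuous.intervalIntegrable (by fun_prop) a b)
      (intervalIntegrable_exp_of_antitone hx a b) fun r hr =>
        Real.exp_le_exp.2 (by linarith [hx hr.2])
  refine le_trans (le_of_eq ?_) (mul_le_mul_of_nonneg_left hdrift (Real.exp_pos (b - a)).le)
  rw [integral_exp_const_add, jumpIntensity, jumpIntensity, mul_left_comm, ← Real.exp_add]
  congr 2
  ring

lemma sum_grid_integral_exp (hx : Antitone fun r => x r - r) (s t : ℝ) (n : ℕ) :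
    ∑ i ∈ Finset.range (n + 1), ∫ r in gridPoint s t n i..gridPoint s t n (i + 1), Real.exp (x r) =
      ∫ r in s..t, Real.exp (x r) := by
  rw [intervalIntegral.sum_integral_adjacent_intervals
    fun i _ => intervalIntegrable_exp_of_antitone hx _ _, gridPoint_zero, gridPoint_last]

lemma integral_exp_le_gridIntensity (hx : Antitone fun r => x r - r) (hst : s ≤ t) (n : ℕ) :
    ∫ r in s..t, Real.exp (x r) ≤ gridIntensity x s t n := by
  rw [← sum_grid_integral_exp hx s t n, gridIntensity]
  refine Finset.sum_le_sum fun i _ => ?_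
  rw [← gridPoint_succ_sub s t n i]
  exact integral_exp_le_jumpIntensity hx (monotone_gridPoint hst n i.le_succ)

lemma gridIntensity_le_integral_exp (hx : Antitone fun r => x r - r) (hst : s ≤ t) (n : ℕ) :
    gridIntensity x s t n ≤ Real.exp ((t - s) / (n + 1)) * (∫ r in s..t, Real.exp (x r)) +
      jumpIntensity ((t - s) / (n + 1)) (x s) := by
  set c := fun i => jumpIntensity ((t - s) / (n + 1)) (x (gridPoint s t n i)) with hc
  have hshift : ∑ i ∈ Finset.range (n + 1), c (i + 1) ≤
      Real.exp ((t - s) / (n + 1)) * ∫ r in s..t, Real.exp (x r) := by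
    rw [← sum_grid_integral_exp hx s t n, Finset.mul_sum]
    refine Finset.sum_le_sum fun i _ => ?_
    rw [hc, ← gridPoint_succ_sub s t n i]
    exact jumpIntensity_le_integral_exp hx (monotone_gridPoint hst n i.le_succ)
  calc gridIntensity x s t n ≤ ∑ i ∈ Finset.range (n + 1 + 1), c i :=
        Finset.sum_le_sum_of_subset_of_nonneg (Finset.range_subset_range.2 (Nat.le_succ _))
          fun i _ _ => jumpIntensity_nonneg (mesh_nonneg hst n) _
    _ = ∑ i ∈ Finset.range (n + 1), c (i + 1) + c 0 := Finset.sum_range_succ' c (n + 1)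
    _ ≤ _ := by
        gcongr
        rw [hc]
        simp only [gridPoint_zero, le_refl]

lemma gridIntensity_le (hx : Antitone fun r => x r - r) (hst : s ≤ t) (n : ℕ) :
    gridIntensity x s t n ≤ jumpIntensity (t - s) (x s) := by
  calc gridIntensity x s t n
      ≤ ∑ i ∈ Finset.range (n + 1),
          jumpIntensity ((t - s) / (n + 1)) (x s + (gridPoint s t n i - s)) :=
        Finset.sum_le_sum fun i _ => monotone_jumpIntensity (mesh_nonneg hst n)
          (by linarith [hx (le_gridPoint hst n i)])
    _ = jumpIntensity (t - s) (x s) := by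
        simp_rw [jumpIntensity_add_gridPoint]
        rw [Finset.sum_range_sub (fun i => Real.exp (x s + (gridPoint s t n i - s))),
          gridPoint_zero, gridPoint_last, jumpIntensity, sub_mul, one_mul, ← Real.exp_add,
          sub_self, add_zero, add_comm (x s)]

lemma tendsto_gridIntensity (hx : Antitone fun r => x r - r) (hst : s ≤ t) :
    Tendsto (gridIntensity x s t) atTop (𝓝 (∫ r in s..t, Real.exp (x r))) := by
  have hexp := (Real.continuous_exp.tendsto 0).comp (tendsto_mesh s t)
  have hfirst := ((continuous_jumpIntensity (x s)).tendsto 0).comp (tendsto_mesh s t)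
  rw [Real.exp_zero] at hexp
  rw [jumpIntensity_zero] at hfirst
  refine tendsto_of_tendsto_of_tendsto_of_le_of_le tendsto_const_nhds ?_
    (integral_exp_le_gridIntensity hx hst) (gridIntensity_le_integral_exp hx hst)
  simpa only [one_mul, add_zero, Function.comp_def] using
    (hexp.mul_const (∫ r in s..t, Real.exp (x r))).add hfirst

lemma dropLaw_le {c : ℝ} (hc : 0 ≤ c) {A : Set ℝ} (hA : MeasurableSet A) :
    dropLaw c A ≤ ENNReal.ofReal c * expMeasure 1 A := by
  rw [dropLaw, withDensity_apply _ hA, ← setLIntegral_const]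
  refine lintegral_mono fun v => ENNReal.ofReal_le_ofReal ?_
  exact mul_le_of_le_one_right hc
    (Real.exp_le_one_iff.2 (neg_nonpos.2 (mul_nonneg hc (Real.exp_pos _).le)))

lemma le_dropLaw {c : ℝ} (hc : 0 ≤ c) {A : Set ℝ} (hA : MeasurableSet A) :
    ENNReal.ofReal (Real.exp (-c) * c) * expMeasure 1 A ≤ dropLaw c A := by
  have hac : (expMeasure 1).restrict A ≪ (volume : Measure ℝ).restrict (Ioi 0) := by
    refine Measure.restrict_le_self.absolutelyContinuous.trans ?_
    rw [expMeasure_one_eq]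
    exact withDensity_absolutelyContinuous _ _
  rw [dropLaw, withDensity_apply _ hA, ← setLIntegral_const, mul_comm]
  refine lintegral_mono_ae ?_
  filter_upwards [hac.ae_le (ae_restrict_mem measurableSet_Ioi)] with v hv
  refine ENNReal.ofReal_le_ofReal (mul_le_mul_of_nonneg_left ?_ hc)
  rw [Real.exp_le_exp, neg_le_neg_iff]
  exact mul_le_of_le_one_right hc (Real.exp_le_one_iff.2 (neg_nonpos.2 (mem_Ioi.1 hv).le))

lemma sum_dropLaw_le {ι : Type*} (I : Finset ι) {c : ι → ℝ} (hc : ∀ i ∈ I, 0 ≤ c i) {A : Set ℝ}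
    (hA : MeasurableSet A) :
    ∑ i ∈ I, dropLaw (c i) A ≤ ENNReal.ofReal (∑ i ∈ I, c i) * expMeasure 1 A := by
  rw [ENNReal.ofReal_sum_of_nonneg hc, Finset.sum_mul]
  exact Finset.sum_le_sum fun i hi => dropLaw_le (hc i hi) hA

lemma le_sum_dropLaw {ι : Type*} (I : Finset ι) {c : ι → ℝ} {C : ℝ} (hc : ∀ i ∈ I, 0 ≤ c i)
    (hC : ∀ i ∈ I, c i ≤ C) {A : Set ℝ} (hA : MeasurableSet A) :
    ENNReal.ofReal (Real.exp (-C) * ∑ i ∈ I, c i) * expMeasure 1 A ≤ ∑ i ∈ I, dropLaw (c i) A := by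
  rw [Finset.mul_sum, ENNReal.ofReal_sum_of_nonneg
    (fun i hi => mul_nonneg (Real.exp_pos _).le (hc i hi)), Finset.sum_mul]
  refine Finset.sum_le_sum fun i hi => le_trans ?_ (le_dropLaw (hc i hi) hA)
  gcongr
  · exact hc i hi
  · exact hC i hi

lemma lintegral_Ioc_ofReal_exp (hx : Antitone fun r => x r - r) (hst : s ≤ t) :
    ∫⁻ r in Ioc s t, ENNReal.ofReal (Real.exp (x r)) =
      ENNReal.ofReal (∫ r in s..t, Real.exp (x r)) := by
  rw [intervalIntegral.integral_of_le hst, ofReal_integral_eq_lintegral_ofReal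
    ((intervalIntegrable_iff_integrableOn_Ioc_of_le hst).1
      (intervalIntegrable_exp_of_antitone hx s t)) (ae_of_all _ fun r => (Real.exp_pos _).le)]

/-- The sum of the masses that the drop laws give to `A` over the intervals of the
grid of mesh `(t - s) / (n + 1)` on `[s, t]`, along the path `x`. -/
def gridDropMass (x : ℝ → ℝ) (s t : ℝ) (A : Set ℝ) (n : ℕ) : ℝ≥0∞ :=
  ∑ i ∈ Finset.range (n + 1), dropLaw (jumpIntensity ((t - s) / (n + 1)) (x (gridPoint s t n i))) A

lemma gridDropMass_le_jumpIntensity (hx : Antitone fun r => x r - r) (hst : s ≤ t) {A : Set ℝ}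
    (hA : MeasurableSet A) (n : ℕ) :
    gridDropMass x s t A n ≤ ENNReal.ofReal (jumpIntensity (t - s) (x s)) :=
  calc gridDropMass x s t A n
      ≤ ENNReal.ofReal (gridIntensity x s t n) * expMeasure 1 A :=
        sum_dropLaw_le _ (fun _ _ => jumpIntensity_nonneg (mesh_nonneg hst n) _) hA
    _ ≤ ENNReal.ofReal (gridIntensity x s t n) := mul_le_of_le_one_right zero_le prob_le_one
    _ ≤ ENNReal.ofReal (jumpIntensity (t - s) (x s)) :=
        ENNReal.ofReal_le_ofReal (gridIntensity_le hx hst n)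

lemma tendsto_gridDropMass (hx : Antitone fun r => x r - r) (hst : s ≤ t) {A : Set ℝ}
    (hA : MeasurableSet A) :
    Tendsto (gridDropMass x s t A) atTop
      (𝓝 (expMeasure 1 A * ∫⁻ r in Ioc s t, ENNReal.ofReal (Real.exp (x r)))) := by
  set C : ℕ → ℝ := fun n => jumpIntensity ((t - s) / (n + 1)) (x s + (t - s))
  have hnonneg (n i : ℕ) : 0 ≤ jumpIntensity ((t - s) / (n + 1)) (x (gridPoint s t n i)) :=
    jumpIntensity_nonneg (mesh_nonneg hst n) _
  have hle (n i : ℕ) (hi : i ∈ Finset.range (n + 1)) :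
      jumpIntensity ((t - s) / (n + 1)) (x (gridPoint s t n i)) ≤ C n :=
    monotone_jumpIntensity (mesh_nonneg hst n)
      (by linarith [hx (le_gridPoint hst n i), gridPoint_le hst (Finset.mem_range.1 hi).le])
  have hC : Tendsto C atTop (𝓝 0) := by
    have := ((continuous_jumpIntensity (x s + (t - s))).tendsto 0).comp (tendsto_mesh s t)
    rwa [jumpIntensity_zero] at this
  have hexp : Tendsto (fun n => Real.exp (-C n)) atTop (𝓝 1) := by
    simpa [Function.comp_def] using (Real.continuous_exp.tendsto _).comp hC.neg
  have hgrid := tendsto_gridIntensity hx hst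
  rw [lintegral_Ioc_ofReal_exp hx hst, mul_comm]
  refine tendsto_of_tendsto_of_tendsto_of_le_of_le ?_
    (ENNReal.Tendsto.mul_const (ENNReal.tendsto_ofReal hgrid) (Or.inr (measure_ne_top _ _)))
    (fun n => le_sum_dropLaw _ (fun i _ => hnonneg n i) (hle n) hA)
    (fun n => sum_dropLaw_le _ (fun i _ => hnonneg n i) hA)
  refine ENNReal.Tendsto.mul_const (ENNReal.tendsto_ofReal ?_) (Or.inr (measure_ne_top _ _))
  simpa only [one_mul, gridIntensity] using hexp.mul hgrid

end CumulativeIntensity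

/-! ### Void probabilities -/

section UpperCylinder

variable {ι : Type*}

/-- The functions that exceed the level `p.2` at the index `p.1`, for each `p ∈ L`. These sets
are a π-system generating the product σ-algebra. -/
def upperCylinder (L : Finset (ι × ℝ)) : Set (ι → ℝ) := {f | ∀ p ∈ L, p.2 < f p.1}

lemma measurableSet_upperCylinder (L : Finset (ι × ℝ)) : MeasurableSet (upperCylinder L) := by
  have h : upperCylinder L = ⋂ p ∈ L, {f : ι → ℝ | p.2 < f p.1} := by
    ext f; simp [upperCylinder]
  rw [h]
  exact L.measurableSet_biInter fun p _ =>
    measurableSet_lt measurable_const (measurable_pi_apply p.1)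

variable (ι)

lemma isPiSystem_upperCylinder :
    IsPiSystem (range (upperCylinder : Finset (ι × ℝ) → Set (ι → ℝ))) := by
  classical
  rintro _ ⟨L, rfl⟩ _ ⟨L', rfl⟩ -
  refine ⟨L ∪ L', ?_⟩
  ext f
  simp only [upperCylinder, mem_ofPred_eq, mem_inter_iff, Finset.mem_union, or_imp, forall_and]

lemma generateFrom_upperCylinder :
    MeasurableSpace.generateFrom (range (upperCylinder : Finset (ι × ℝ) → Set (ι → ℝ))) =
      MeasurableSpace.pi := by
  refine le_antisymm (MeasurableSpace.generateFrom_le ?_) (iSup_le fun i => ?_)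
  · rintro _ ⟨L, rfl⟩
    exact measurableSet_upperCylinder L
  · rw [BorelSpace.measurable_eq (α := ℝ), borel_eq_generateFrom_Ioi ℝ,
      MeasurableSpace.comap_generateFrom]
    refine MeasurableSpace.generateFrom_mono ?_
    rintro _ ⟨_, ⟨z, rfl⟩, rfl⟩
    exact ⟨{(i, z)}, by ext f; simp [upperCylinder]⟩

lemma isCountablySpanning_upperCylinder :
    IsCountablySpanning (range (upperCylinder : Finset (ι × ℝ) → Set (ι → ℝ))) :=
  ⟨fun _ => univ, fun _ => ⟨∅, by ext f; simp [upperCylinder]⟩, iUnion_const univ⟩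

lemma isCountablySpanning_Ioi : IsCountablySpanning (range (Ioi : ℝ → Set ℝ)) := by
  refine ⟨fun n => Ioi (-(n : ℝ)), fun n => mem_range_self _,
    eq_univ_of_forall fun x => mem_iUnion.2 ?_⟩
  obtain ⟨n, hn⟩ := exists_nat_gt (-x)
  exact ⟨n, mem_Ioi.2 (neg_lt.1 hn)⟩

end UpperCylinder

section VoidProbability

/-- The intensity measure of the marked points `(x, u)` of the interlacement. -/
def pointRate : Measure (ℝ × ℝ) :=
  (volume : Measure ℝ).prod ((volume : Measure ℝ).restrict (Ici 0))

/-- The probability that a Poisson point process with intensity `pointRate` has no point in `E`.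
This is meant for sets `E` of finite intensity: otherwise `toReal` makes it `1`. -/
def voidProb (E : Set (ℝ × ℝ)) : ℝ≥0∞ := ENNReal.ofReal (Real.exp (-(pointRate E).toReal))

/-- The box that is void of points if and only if the process exceeds `y` at time `β`: solving
`y < β + log (log r) + log 2` for `log r` gives `exp (y - β) / 2 < log r`. -/
def voidBox (β y : ℝ) : Set (ℝ × ℝ) := Icc 0 (Real.exp (y - β) / 2) ×ˢ Iic (2 * Real.exp β)

/-- The region that is void of points if and only if the process exceeds `p.2` at time `g p.1`,
for each `p ∈ L`. -/
def voidRegion {ι : Type*} (g : ι → ℝ) (L : Finset (ι × ℝ)) : Set (ℝ × ℝ) :=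
  ⋃ p ∈ L, voidBox (g p.1) p.2

variable {ι : Type*} (g : ι → ℝ) (L : Finset (ι × ℝ))

lemma measurableSet_voidRegion : MeasurableSet (voidRegion g L) :=
  L.measurableSet_biUnion fun _ _ => measurableSet_Icc.prod measurableSet_Iic

lemma pointRate_Icc_prod (a : ℝ) {B : Set ℝ} (hB : MeasurableSet B) :
    pointRate (Icc 0 a ×ˢ B) = ENNReal.ofReal a * volume (B ∩ Ici 0) := by
  rw [pointRate, Measure.prod_prod, Measure.restrict_apply hB, Real.volume_Icc, sub_zero]

lemma pointRate_Icc_prod_Iic (a b : ℝ) :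
    pointRate (Icc 0 a ×ˢ Iic b) = ENNReal.ofReal a * ENNReal.ofReal b := by
  rw [pointRate_Icc_prod a measurableSet_Iic, Iic_inter_Ici, Real.volume_Icc, sub_zero]

lemma pointRate_Icc_prod_Ioc (a : ℝ) {b : ℝ} (hb : 0 ≤ b) (c : ℝ) :
    pointRate (Icc 0 a ×ˢ Ioc b c) = ENNReal.ofReal a * ENNReal.ofReal (c - b) := by
  rw [pointRate_Icc_prod a measurableSet_Ioc,
    inter_eq_left.2 (show Ioc b c ⊆ Ici 0 from fun u hu => hb.trans hu.1.le), Real.volume_Ioc]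

lemma pointRate_voidBox (β y : ℝ) : pointRate (voidBox β y) = ENNReal.ofReal (Real.exp y) := by
  rw [voidBox, pointRate_Icc_prod_Iic, ← ENNReal.ofReal_mul (by positivity), Real.exp_sub]
  congr 1
  field_simp

lemma pointRate_voidRegion_lt_top : pointRate (voidRegion g L) < ∞ := by
  refine (measure_biUnion_finset_le L _).trans_lt (ENNReal.sum_lt_top.2 fun p _ => ?_)
  rw [pointRate_voidBox]
  exact ENNReal.ofReal_lt_top

lemma voidProb_union {E F : Set (ℝ × ℝ)} (hEF : Disjoint E F) (hF : MeasurableSet F)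
    (hE' : pointRate E ≠ ∞) (hF' : pointRate F ≠ ∞) :
    voidProb (E ∪ F) = voidProb F * voidProb E := by
  rw [voidProb, measure_union hEF hF, ENNReal.toReal_add hE' hF', neg_add, add_comm, Real.exp_add,
    ENNReal.ofReal_mul (Real.exp_pos _).le, voidProb, voidProb]

/-- The scaling of the points that corresponds to the time shift by `h`. -/
def pointScaling (h : ℝ) : ℝ × ℝ → ℝ × ℝ :=
  Prod.map (fun x => Real.exp h * x) (fun u => Real.exp (-h) * u)

lemma map_volume_exp_mul (h : ℝ) :
    Measure.map (fun x => Real.exp h * x) (volume : Measure ℝ) =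
      ENNReal.ofReal (Real.exp (-h)) • volume := by
  rw [Real.map_volume_mul_left (Real.exp_pos h).ne', ← Real.exp_neg, abs_of_pos (Real.exp_pos _)]

lemma measurePreserving_pointScaling (h : ℝ) :
    MeasurePreserving (pointScaling h) pointRate pointRate := by
  refine ⟨by unfold pointScaling; fun_prop, ?_⟩
  have hhalf : Measure.map (fun x => Real.exp (-h) * x) ((volume : Measure ℝ).restrict (Ici 0)) =
      ENNReal.ofReal (Real.exp h) • (volume : Measure ℝ).restrict (Ici 0) := by
    have hpre : (fun x => Real.exp (-h) * x) ⁻¹' Ici 0 = Ici 0 := by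
      ext x; simp [mul_nonneg_iff_of_pos_left (Real.exp_pos (-h))]
    rw [← hpre, ← Measure.restrict_map (by fun_prop) measurableSet_Ici, map_volume_exp_mul,
      neg_neg, Measure.restrict_smul, hpre]
  rw [pointScaling, pointRate, ← Measure.map_prod_map _ _ (by fun_prop) (by fun_prop),
    map_volume_exp_mul, hhalf, Measure.prod_smul_left, Measure.prod_smul_right, smul_smul,
    ← ENNReal.ofReal_mul (Real.exp_pos _).le, ← Real.exp_add]
  simp

lemma pointScaling_preimage_voidBox (h β y : ℝ) :
    pointScaling h ⁻¹' voidBox β y = voidBox (β + h) y := by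
  have hx : Real.exp (y - β) / 2 = Real.exp h * (Real.exp (y - (β + h)) / 2) := by
    rw [mul_div_assoc', ← Real.exp_add]
    congr 2
    ring
  have hu : 2 * Real.exp β = Real.exp (-h) * (2 * Real.exp (β + h)) := by
    rw [mul_left_comm, ← Real.exp_add]
    congr 2
    ring
  ext ⟨x, u⟩
  simp only [pointScaling, voidBox, mem_preimage, Prod.map_apply, mem_prod, mem_Icc, mem_Iic]
  rw [mul_nonneg_iff_of_pos_left (Real.exp_pos h), hx, mul_le_mul_iff_right₀ (Real.exp_pos h), hu,
    mul_le_mul_iff_right₀ (Real.exp_pos (-h))]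

lemma voidProb_voidRegion_add (h : ℝ) :
    voidProb (voidRegion (fun i => g i + h) L) = voidProb (voidRegion g L) := by
  rw [voidProb, voidProb, ← (measurePreserving_pointScaling h).measure_preimage
    (measurableSet_voidRegion g L).nullMeasurableSet]
  simp only [voidRegion, preimage_iUnion, pointScaling_preimage_voidBox]

/-- The points `(x, u)` of `voidBox (s + t) z` with `u ≤ 2 exp s` form `voidBox s (z - t)`; the
remaining ones are independent of everything that happened up to time `s`. -/
lemma voidProb_voidBox_add_union (s z : ℝ) (t : ℝ≥0) {U : Set (ℝ × ℝ)}
    (hU : U ⊆ univ ×ˢ Iic (2 * Real.exp s)) (hU' : pointRate U ≠ ∞) :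
    voidProb (voidBox (s + t) z ∪ U) =
      ENNReal.ofReal (Real.exp (-((1 - Real.exp (-t)) * Real.exp z))) *
        voidProb (voidBox s (z - t) ∪ U) := by
  set new : Set (ℝ × ℝ) := Icc 0 (Real.exp (z - (s + t)) / 2) ×ˢ
    Ioc (2 * Real.exp s) (2 * Real.exp (s + t)) with hnew
  have hbox : voidBox (s + t) z = voidBox s (z - t) ∪ new := by
    have hst : Real.exp s ≤ Real.exp (s + t) := Real.exp_le_exp.2 (by simp)
    rw [voidBox, voidBox, show z - t - s = z - (s + t) by ring, hnew, ← prod_union,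
      Iic_union_Ioc_eq_Iic (by linarith)]
  have hrate : pointRate new = ENNReal.ofReal ((1 - Real.exp (-t)) * Real.exp z) := by
    rw [hnew, pointRate_Icc_prod_Ioc _ (by positivity), ← ENNReal.ofReal_mul (by positivity)]
    congr 1
    rw [Real.exp_sub, Real.exp_add, Real.exp_neg]
    field_simp
  have hdisj : Disjoint (voidBox s (z - t) ∪ U) new := by
    refine Disjoint.mono_left (union_subset (prod_mono_left (subset_univ _)) hU) ?_
    exact Set.disjoint_prod.2 (Or.inr (Iic_disjoint_Ioc le_rfl))
  have hnonneg : 0 ≤ (1 - Real.exp (-t)) * Real.exp z :=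
    mul_nonneg (sub_nonneg.2 (Real.exp_le_one_iff.2 (by simp))) (Real.exp_pos z).le
  rw [hbox, union_right_comm, voidProb_union hdisj (measurableSet_Icc.prod measurableSet_Ioc) _
    (hrate ▸ ENNReal.ofReal_ne_top), voidProb, hrate, ENNReal.toReal_ofReal hnonneg]
  refine (measure_union_lt_top ?_ hU'.lt_top).ne
  rw [pointRate_voidBox]
  exact ENNReal.ofReal_lt_top

end VoidProbability

/-! ### The Markov property -/

section MarkovProperty

variable {Ω : Type*} [MeasurableSpace Ω] {X : ℝ → Ω → ℝ} {P : Measure Ω}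

/-- The process `X` has the finite-dimensional laws given by the void probabilities of a Poisson
point process with intensity `pointRate`, and its paths are unit drifts with isolated downward
jumps. -/
structure IsVoidProcess (X : ℝ → Ω → ℝ) (P : Measure Ω) : Prop where
  aemeasurable_path : AEMeasurable (fun ω β => X β ω) P
  void : ∀ L : Finset (ℝ × ℝ), P {ω | ∀ p ∈ L, p.2 < X p.1 ω} = voidProb (voidRegion id L)
  path : ∀ᵐ ω ∂P, IsDriftJumpPath X ω
  antitone : ∀ᵐ ω ∂P, Antitone fun r => X r ω - r

namespace IsVoidProcess

lemma aemeasurable (hX : IsVoidProcess X P) (β : ℝ) : AEMeasurable (X β) P :=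
  (measurable_pi_apply β).comp_aemeasurable hX.aemeasurable_path

lemma aemeasurable_comp (hX : IsVoidProcess X P) {ι : Type*} (g : ι → ℝ) :
    AEMeasurable (fun ω i => X (g i) ω) P :=
  Measurable.comp_aemeasurable (g := fun (f : ℝ → ℝ) i => f (g i)) (by fun_prop)
    hX.aemeasurable_path

lemma measure_forall_lt (hX : IsVoidProcess X P) {ι : Type*} (g : ι → ℝ) (L : Finset (ι × ℝ)) :
    P {ω | ∀ p ∈ L, p.2 < X (g p.1) ω} = voidProb (voidRegion g L) := by
  classical
  have h := hX.void (L.image (Prod.map g id))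
  simp only [voidRegion, Finset.set_biUnion_finset_image, Finset.forall_mem_image] at h
  exact h

lemma measure_pastEvent_inter_lt (hX : IsVoidProcess X P) {s : ℝ} (L : Finset (Iic s × ℝ))
    (r z : ℝ) :
    P (pastEvent X s (upperCylinder L) ∩ {ω | z < X r ω}) =
      voidProb (voidBox r z ∪ voidRegion (↑) L) := by
  classical
  have h := hX.void (insert (r, z) (L.image (Prod.map (↑) id)))
  simp only [voidRegion, Finset.set_biUnion_insert, Finset.set_biUnion_finset_image,
    Finset.forall_mem_insert, Finset.forall_mem_image] at h
  rw [inter_comm]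
  exact h

lemma setLIntegral_map_past (hX : IsVoidProcess X P) {s : ℝ} {F : Set (Iic s → ℝ)}
    (hF : MeasurableSet F) {φ : (Iic s → ℝ) → ℝ≥0∞} (hφ : Measurable φ) :
    ∫⁻ f in F, φ f ∂(P.map fun ω (r : Iic s) => X r ω) =
      ∫⁻ ω in pastEvent X s F, φ (fun r : Iic s => X r ω) ∂P := by
  have hm := hX.aemeasurable_comp ((↑) : Iic s → ℝ)
  rw [Measure.restrict_map_of_aemeasurable hm hF, lintegral_map' hφ.aemeasurable hm.restrict]
  rfl

lemma lintegral_pastEvent_transitionLaw_Ioi (hX : IsVoidProcess X P) {s : ℝ} (t : ℝ≥0)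
    (L : Finset (Iic s × ℝ)) (z : ℝ) :
    ∫⁻ ω in pastEvent X s (upperCylinder L), transitionLaw t (X s ω) (Ioi z) ∂P =
      P (pastEvent X s (upperCylinder L) ∩ {ω | z < X (s + t) ω}) := by
  have hlt : NullMeasurableSet {ω | z - t < X s ω}
      (P.restrict (pastEvent X s (upperCylinder L))) :=
    (hX.aemeasurable s).restrict.nullMeasurableSet_preimage measurableSet_Ioi
  have hU : voidRegion (↑) L ⊆ univ ×ˢ Iic (2 * Real.exp s) := by
    refine iUnion₂_subset fun p _ => prod_mono (subset_univ _) (Iic_subset_Iic.2 ?_)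
    gcongr
    exact p.1.2
  calc ∫⁻ ω in pastEvent X s (upperCylinder L), transitionLaw t (X s ω) (Ioi z) ∂P
      = ∫⁻ ω in pastEvent X s (upperCylinder L), {ω | z - t < X s ω}.indicator
          (fun _ => ENNReal.ofReal (Real.exp (-((1 - Real.exp (-t)) * Real.exp z)))) ω ∂P := by
        simp only [transitionLaw_Ioi]; rfl
    _ = ENNReal.ofReal (Real.exp (-((1 - Real.exp (-t)) * Real.exp z))) *
          voidProb (voidBox s (z - t) ∪ voidRegion (↑) L) := by
        rw [lintegral_indicator_const₀ hlt, Measure.restrict_apply₀ hlt,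
          inter_comm, hX.measure_pastEvent_inter_lt]
    _ = P (pastEvent X s (upperCylinder L) ∩ {ω | z < X (s + t) ω}) := by
        rw [hX.measure_pastEvent_inter_lt, voidProb_voidBox_add_union s z t hU
          (pointRate_voidRegion_lt_top _ L).ne]

variable [IsProbabilityMeasure P]

lemma isStationary (hX : IsVoidProcess X P) : IsStationary X P := by
  intro h
  have hm := hX.aemeasurable_comp (· + h)
  refine ⟨hm, hX.aemeasurable_path, ?_⟩
  have := Measure.isProbabilityMeasure_map (μ := P) hm
  have := Measure.isProbabilityMeasure_map (μ := P) hX.aemeasurable_path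
  refine ext_of_generate_finite _ (generateFrom_upperCylinder ℝ).symm
    (isPiSystem_upperCylinder ℝ) ?_ (by simp only [measure_univ])
  rintro _ ⟨L, rfl⟩
  rw [Measure.map_apply_of_aemeasurable hm (measurableSet_upperCylinder L),
    Measure.map_apply_of_aemeasurable hX.aemeasurable_path (measurableSet_upperCylinder L)]
  exact (hX.measure_forall_lt (· + h) L).trans ((voidProb_voidRegion_add id L h).trans
    (hX.void L).symm)

lemma hasLaw (hX : IsVoidProcess X P) (β : ℝ) : HasLaw (X β) negGumbel P := by
  refine ⟨hX.aemeasurable β, ?_⟩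
  have := Measure.isProbabilityMeasure_map (μ := P) (hX.aemeasurable β)
  refine ext_of_Ioi fun y => ?_
  have h := hX.void {(β, y)}
  rw [voidRegion, Finset.set_biUnion_singleton, voidProb, id, pointRate_voidBox,
    ENNReal.toReal_ofReal (Real.exp_pos y).le] at h
  simp only [Finset.mem_singleton, forall_eq] at h
  rw [Measure.map_apply_of_aemeasurable (hX.aemeasurable β) measurableSet_Ioi, negGumbel_Ioi]
  exact h

/-- The transition kernel, as a kernel from the past up to time `s`, on which it depends only
through the present. -/
def pastKernel (s : ℝ) (t : ℝ≥0) : Kernel (Iic s → ℝ) ℝ :=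
  (transitionKernel t).comap (fun f => f ⟨s, self_mem_Iic⟩) (measurable_pi_apply _)

instance (s : ℝ) (t : ℝ≥0) : IsMarkovKernel (pastKernel s t) := by
  unfold pastKernel; infer_instance

lemma map_past_future (hX : IsVoidProcess X P) (s : ℝ) (t : ℝ≥0) :
    P.map (fun ω => (fun r : Iic s => X r ω, X (s + t) ω)) =
      (P.map fun ω (r : Iic s) => X r ω) ⊗ₘ pastKernel s t := by
  have hpast := hX.aemeasurable_comp ((↑) : Iic s → ℝ)
  have hm := hpast.prodMk (hX.aemeasurable (s + t))
  have := Measure.isProbabilityMeasure_map (μ := P) hm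
  have := Measure.isProbabilityMeasure_map (μ := P) hpast
  refine ext_of_generate_finite _ (generateFrom_eq_prod (generateFrom_upperCylinder (Iic s))
    (BorelSpace.measurable_eq.trans (borel_eq_generateFrom_Ioi ℝ)).symm
    (isCountablySpanning_upperCylinder _) isCountablySpanning_Ioi).symm
    ((isPiSystem_upperCylinder _).prod isPiSystem_Ioi) ?_ (by simp only [measure_univ])
  rintro _ ⟨_, ⟨L, rfl⟩, _, ⟨z, rfl⟩, rfl⟩
  have hL := measurableSet_upperCylinder L
  rw [Measure.map_apply_of_aemeasurable hm (hL.prod measurableSet_Ioi),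
    Measure.compProd_apply_prod hL measurableSet_Ioi,
    hX.setLIntegral_map_past hL (Kernel.measurable_coe _ measurableSet_Ioi)]
  exact (hX.lintegral_pastEvent_transitionLaw_Ioi t L z).symm

lemma measure_pastEvent_inter_mem (hX : IsVoidProcess X P) {s : ℝ} (t : ℝ≥0)
    {F : Set (Iic s → ℝ)} (hF : MeasurableSet F) {D : Set (ℝ × ℝ)} (hD : MeasurableSet D) :
    P (pastEvent X s F ∩ {ω | (X s ω, X (s + t) ω) ∈ D}) =
      ∫⁻ ω in pastEvent X s F, transitionLaw t (X s ω) {z | (X s ω, z) ∈ D} ∂P := by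
  have hm := (hX.aemeasurable_comp ((↑) : Iic s → ℝ)).prodMk (hX.aemeasurable (s + t))
  set E : Set ((Iic s → ℝ) × ℝ) := {q | (q.1 ⟨s, self_mem_Iic⟩, q.2) ∈ D}
  have hE : MeasurableSet E := hD.preimage (by fun_prop)
  have hFE : MeasurableSet (Prod.fst ⁻¹' F ∩ E) := (hF.preimage measurable_fst).inter hE
  calc P (pastEvent X s F ∩ {ω | (X s ω, X (s + t) ω) ∈ D})
      = P.map (fun ω => (fun r : Iic s => X r ω, X (s + t) ω)) (Prod.fst ⁻¹' F ∩ E) :=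
        (Measure.map_apply_of_aemeasurable hm hFE).symm
    _ = ∫⁻ f in F, pastKernel s t f (Prod.mk f ⁻¹' E) ∂(P.map fun ω (r : Iic s) => X r ω) := by
        rw [hX.map_past_future, Measure.compProd_apply hFE, ← lintegral_indicator hF]
        refine lintegral_congr fun f => ?_
        by_cases hf : f ∈ F <;> simp [hf, preimage_preimage]
    _ = ∫⁻ ω in pastEvent X s F, transitionLaw t (X s ω) {z | (X s ω, z) ∈ D} ∂P :=
        hX.setLIntegral_map_past hF (Kernel.measurable_kernel_prodMk_left hE)

lemma isMarkovProcess (hX : IsVoidProcess X P) : IsMarkovProcess X transitionKernel P :=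
  fun _ t _ _ hF hB => hX.measure_pastEvent_inter_mem t hF (measurable_snd hB)

end IsVoidProcess

end MarkovProperty

/-! ### The stochastic intensity of the jumps -/

section Intensity

lemma transitionLaw_drop (t : ℝ≥0) (y : ℝ) {A : Set ℝ} (hA : MeasurableSet A) (h0 : 0 ∉ A) :
    transitionLaw t y {z | y + t - z ∈ A} = dropLaw (jumpIntensity t y) A := by
  have hm : MeasurableSet {z : ℝ | y + t - z ∈ A} :=
    hA.preimage (f := fun z => y + t - z) (by fun_prop)
  have hstay : y + t ∉ {z : ℝ | y + t - z ∈ A} := by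
    simpa only [mem_ofPred_eq, sub_self] using h0
  rw [transitionLaw, Measure.add_apply, Measure.smul_apply, Measure.dirac_apply' _ hm,
    indicator_of_notMem hstay, smul_zero, zero_add, Measure.map_apply (by fun_prop) hm]
  simp only [preimage_ofPred_eq, sub_sub_cancel, ofPred_mem_eq]

lemma measurable_dropLaw {A : Set ℝ} (hA : MeasurableSet A) : Measurable fun c => dropLaw c A := by
  simp_rw [dropLaw, withDensity_apply _ hA]
  exact Measurable.lintegral_prod_right' (f := fun p : ℝ × ℝ =>
    ENNReal.ofReal (p.1 * Real.exp (-(p.1 * Real.exp (-p.2))))) (by fun_prop)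

lemma expMeasure_diff_zero (A : Set ℝ) : expMeasure 1 (A \ {0}) = expMeasure 1 A := by
  have hac : expMeasure 1 ≪ (volume : Measure ℝ) := withDensity_absolutelyContinuous _ _
  exact measure_sdiff_null (hac (measure_singleton 0))

variable {Ω : Type*} [MeasurableSpace Ω] {X : ℝ → Ω → ℝ} {P : Measure Ω}

namespace IsVoidProcess

lemma aemeasurable_drop (hX : IsVoidProcess X P) (a b : ℝ) : AEMeasurable (drop X a b) P :=
  ((hX.aemeasurable a).add_const _).sub (hX.aemeasurable b)

lemma aemeasurable_gridDropCount (hX : IsVoidProcess X P) (s t : ℝ) {A : Set ℝ}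
    (hA : MeasurableSet A) (n : ℕ) : AEMeasurable (gridDropCount X s t A n) P :=
  Finset.aemeasurable_fun_sum _ fun _ _ =>
    (measurable_one.indicator hA).comp_aemeasurable (hX.aemeasurable_drop _ _)

lemma aemeasurable_dropLaw (hX : IsVoidProcess X P) (h a : ℝ) {A : Set ℝ}
    (hA : MeasurableSet A) : AEMeasurable (fun ω => dropLaw (jumpIntensity h (X a ω)) A) P := by
  have hc : Measurable (jumpIntensity h) := by unfold jumpIntensity; fun_prop
  exact ((measurable_dropLaw hA).comp hc).comp_aemeasurable (hX.aemeasurable a)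

lemma aemeasurable_jumpCount (hX : IsVoidProcess X P) (s t : ℝ) {A : Set ℝ}
    (hA : MeasurableSet A) : AEMeasurable (jumpCount X s t A) P := by
  rcases le_or_gt s t with hst | hst
  · refine aemeasurable_of_tendsto_metrizable_ae atTop
      (hX.aemeasurable_gridDropCount s t (hA.diff (measurableSet_singleton 0))) ?_
    filter_upwards [hX.path] with ω hω
    rw [← jumpCount_diff_zero]
    exact hω.tendsto_gridDropCount hst fun h => h.2 rfl
  · have : jumpCount X s t A = 0 := by
      funext ω; simp [jumpCount, jumpTimes, Ioc_eq_empty_of_le hst.le]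
    rw [this]
    exact aemeasurable_zero

variable [IsProbabilityMeasure P]

lemma lintegral_exp (hX : IsVoidProcess X P) (s : ℝ) :
    ∫⁻ ω, ENNReal.ofReal (Real.exp (X s ω)) ∂P = 1 := by
  have htail : ∀ r ∈ Ioi (0 : ℝ),
      P {ω | r < Real.exp (X s ω)} = ENNReal.ofReal (Real.exp (-r)) := by
    intro r hr
    simp_rw [← Real.log_lt_iff_lt_exp hr]
    rw [(hX.hasLaw s).measure_eq measurableSet_Ioi]
    exact (negGumbel_Ioi _).trans (by rw [Real.exp_log hr])
  rw [lintegral_eq_lintegral_meas_lt P (ae_of_all _ fun ω => (Real.exp_pos _).le)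
    (Real.measurable_exp.comp_aemeasurable (hX.aemeasurable s)),
    setLIntegral_congr_fun measurableSet_Ioi htail,
    ← ofReal_integral_eq_lintegral_ofReal (integrableOn_exp_neg_Ioi 0)
      (ae_of_all _ fun r => (Real.exp_pos _).le), integral_exp_neg_Ioi, neg_zero, Real.exp_zero,
    ENNReal.ofReal_one]

lemma lintegral_jumpIntensity_lt_top (hX : IsVoidProcess X P) {h : ℝ} (hh : 0 ≤ h) (s : ℝ) :
    ∫⁻ ω, ENNReal.ofReal (jumpIntensity h (X s ω)) ∂P < ∞ := by
  simp_rw [jumpIntensity, ENNReal.ofReal_mul (sub_nonneg.2 (Real.one_le_exp hh))]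
  rw [lintegral_const_mul' _ _ ENNReal.ofReal_ne_top, hX.lintegral_exp, mul_one]
  exact ENNReal.ofReal_lt_top

lemma finite_intensity (hX : IsVoidProcess X P) (s t : ℝ) :
    ∫⁻ ω, (∫⁻ r in Ioc s t, ENNReal.ofReal (Real.exp (X r ω))) ∂P < ∞ := by
  rcases le_or_gt s t with hst | hst
  · refine (lintegral_mono_ae ?_).trans_lt
      (hX.lintegral_jumpIntensity_lt_top (sub_nonneg.2 hst) s)
    filter_upwards [hX.antitone] with ω hω
    rw [lintegral_Ioc_ofReal_exp (x := fun r => X r ω) hω hst]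
    exact ENNReal.ofReal_le_ofReal (integral_exp_le_jumpIntensity hω hst)
  · simp [Ioc_eq_empty_of_le hst.le]

lemma measure_pastEvent_inter_drop (hX : IsVoidProcess X P) {s a b : ℝ} (hsa : s ≤ a)
    (hab : a ≤ b) {F : Set (Iic s → ℝ)} (hF : MeasurableSet F) {A : Set ℝ} (hA : MeasurableSet A)
    (h0 : 0 ∉ A) :
    P (pastEvent X s F ∩ {ω | drop X a b ω ∈ A}) =
      ∫⁻ ω in pastEvent X s F, dropLaw (jumpIntensity (b - a) (X a ω)) A ∂P := by
  obtain ⟨t, rfl⟩ : ∃ t : ℝ≥0, b = a + t := ⟨(b - a).toNNReal, by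
    rw [Real.coe_toNNReal _ (sub_nonneg.2 hab), add_sub_cancel]⟩
  set restr : (Iic a → ℝ) → Iic s → ℝ := fun f r => f ⟨r, Iic_subset_Iic.2 hsa r.2⟩
  have hG : MeasurableSet (restr ⁻¹' F) :=
    hF.preimage (measurable_pi_lambda _ fun _ => measurable_pi_apply _)
  have hD : MeasurableSet {p : ℝ × ℝ | p.1 + t - p.2 ∈ A} :=
    hA.preimage (f := fun p : ℝ × ℝ => p.1 + t - p.2) (by fun_prop)
  have h := hX.measure_pastEvent_inter_mem t hG hD
  simp only [mem_ofPred_eq, transitionLaw_drop t _ hA h0] at h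
  simp only [drop, add_sub_cancel_left]
  exact h

lemma setLIntegral_gridDropCount (hX : IsVoidProcess X P) {s t : ℝ} (hst : s ≤ t)
    {F : Set (Iic s → ℝ)} (hF : MeasurableSet F) {A : Set ℝ} (hA : MeasurableSet A)
    (h0 : 0 ∉ A) (n : ℕ) :
    ∫⁻ ω in pastEvent X s F, gridDropCount X s t A n ω ∂P =
      ∫⁻ ω in pastEvent X s F, gridDropMass (fun r => X r ω) s t A n ∂P := by
  have hcount : ∀ i, AEMeasurable (fun ω => A.indicator (1 : ℝ → ℝ≥0∞)
      (drop X (gridPoint s t n i) (gridPoint s t n (i + 1)) ω)) (P.restrict (pastEvent X s F)) :=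
    fun i => ((measurable_one.indicator hA).comp_aemeasurable (hX.aemeasurable_drop _ _)).restrict
  simp only [gridDropCount, gridDropMass]
  rw [lintegral_finsetSum' _ fun i _ => hcount i,
    lintegral_finsetSum' _ fun i _ => (hX.aemeasurable_dropLaw _ _ hA).restrict]
  refine Finset.sum_congr rfl fun i _ => ?_
  set a := gridPoint s t n i
  set b := gridPoint s t n (i + 1)
  have hdrop : NullMeasurableSet {ω | drop X a b ω ∈ A} (P.restrict (pastEvent X s F)) :=
    (hX.aemeasurable_drop a b).restrict.nullMeasurableSet_preimage hA
  rw [← gridPoint_succ_sub s t n i, ← hX.measure_pastEvent_inter_drop (le_gridPoint hst n i)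
    (monotone_gridPoint hst n i.le_succ) hF hA h0, inter_comm, ← Measure.restrict_apply₀ hdrop,
    ← lintegral_indicator_one₀ hdrop]
  rfl

lemma tendsto_setLIntegral_gridDropCount (hX : IsVoidProcess X P) {s t : ℝ} (hst : s ≤ t)
    {F : Set (Iic s → ℝ)} (hF : MeasurableSet F) {A : Set ℝ} (hA : MeasurableSet A)
    (h0 : 0 ∉ A) :
    Tendsto (fun n => ∫⁻ ω in pastEvent X s F, gridDropCount X s t A n ω ∂P) atTop
      (𝓝 (expMeasure 1 A * ∫⁻ ω in pastEvent X s F,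
        (∫⁻ r in Ioc s t, ENNReal.ofReal (Real.exp (X r ω))) ∂P)) := by
  simp_rw [hX.setLIntegral_gridDropCount hst hF hA h0]
  rw [← lintegral_const_mul' _ _ (measure_ne_top _ _)]
  refine tendsto_lintegral_of_dominated_convergence'
    (fun ω => ENNReal.ofReal (jumpIntensity (t - s) (X s ω)))
    (fun n => Finset.aemeasurable_fun_sum _ fun i _ => (hX.aemeasurable_dropLaw _ _ hA).restrict)
    (fun n => ?_) ?_ ?_
  · filter_upwards [ae_restrict_of_ae hX.antitone] with ω hω
    exact gridDropMass_le_jumpIntensity (x := fun r => X r ω) hω hst hA n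
  · exact ((setLIntegral_le_lintegral _ _).trans_lt
      (hX.lintegral_jumpIntensity_lt_top (sub_nonneg.2 hst) s)).ne
  · filter_upwards [ae_restrict_of_ae hX.antitone] with ω hω
    exact tendsto_gridDropMass (x := fun r => X r ω) hω hst hA

lemma setLIntegral_jumpCount_univ_lt_top (hX : IsVoidProcess X P) {s t : ℝ} (hst : s ≤ t)
    {F : Set (Iic s → ℝ)} (hF : MeasurableSet F) :
    ∫⁻ ω in pastEvent X s F, jumpCount X s t univ ω ∂P < ∞ := by
  have hA : MeasurableSet (univ \ {0} : Set ℝ) := .diff .univ (measurableSet_singleton 0)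
  have h0 : (0 : ℝ) ∉ univ \ {0} := fun h => h.2 rfl
  calc ∫⁻ ω in pastEvent X s F, jumpCount X s t univ ω ∂P
      = ∫⁻ ω in pastEvent X s F,
          liminf (fun n => gridDropCount X s t (univ \ {0}) n ω) atTop ∂P := by
        refine lintegral_congr_ae (ae_restrict_of_ae ?_)
        filter_upwards [hX.path] with ω hω
        rw [(hω.tendsto_gridDropCount hst h0).liminf_eq, jumpCount_diff_zero]
    _ ≤ liminf (fun n => ∫⁻ ω in pastEvent X s F, gridDropCount X s t (univ \ {0}) n ω ∂P) atTop :=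
        lintegral_liminf_le' fun n => (hX.aemeasurable_gridDropCount s t hA n).restrict
    _ = expMeasure 1 (univ \ {0}) * ∫⁻ ω in pastEvent X s F,
          (∫⁻ r in Ioc s t, ENNReal.ofReal (Real.exp (X r ω))) ∂P :=
        (hX.tendsto_setLIntegral_gridDropCount hst hF hA h0).liminf_eq
    _ < ∞ := ENNReal.mul_lt_top (measure_lt_top _ _)
        ((setLIntegral_le_lintegral _ _).trans_lt (hX.finite_intensity s t))

lemma intensity (hX : IsVoidProcess X P) {s t : ℝ} (hst : s ≤ t) {F : Set (Iic s → ℝ)}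
    (hF : MeasurableSet F) {A : Set ℝ} (hA : MeasurableSet A) :
    ∫⁻ ω in pastEvent X s F, jumpCount X s t A ω ∂P =
      expMeasure 1 A * ∫⁻ ω in pastEvent X s F,
        (∫⁻ r in Ioc s t, ENNReal.ofReal (Real.exp (X r ω))) ∂P := by
  have hA' := hA.diff (measurableSet_singleton 0)
  have h0 : (0 : ℝ) ∉ A \ {0} := fun h => h.2 rfl
  have hlim := hX.tendsto_setLIntegral_gridDropCount hst hF hA' h0
  rw [expMeasure_diff_zero] at hlim
  refine tendsto_nhds_unique ?_ hlim
  refine tendsto_lintegral_of_dominated_convergence' (jumpCount X s t univ)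
    (fun n => (hX.aemeasurable_gridDropCount s t hA' n).restrict) (fun n => ?_)
    (hX.setLIntegral_jumpCount_univ_lt_top hst hF).ne ?_
  · filter_upwards [ae_restrict_of_ae hX.path] with ω hω
    exact hω.gridDropCount_le hst h0 n
  · filter_upwards [ae_restrict_of_ae hX.path] with ω hω
    rw [← jumpCount_diff_zero]
    exact hω.tendsto_gridDropCount hst h0

theorem solvesJumpSDE (hX : IsVoidProcess X P) :
    SolvesJumpSDE X Real.exp (expMeasure 1) P where
  cadlag := hX.path.mono fun _ hω => hω.cadlag
  equation := hX.path.mono fun ω hω s t hst => by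
    obtain ⟨hfin, hsum⟩ := hω.jumpEquation hst
    refine ⟨hfin, ?_⟩
    rw [← hsum, drop]
    ring
  aemeasurable_jumpCount s t _ hA := hX.aemeasurable_jumpCount s t hA
  finite_intensity := hX.finite_intensity
  intensity _ _ hst _ _ hF hA := hX.intensity hst hF hA

end IsVoidProcess

end Intensity

/-! ### Configurations of points -/

section Configurations

/-- There are finitely many points in bounded regions of the right half-plane, at least one point
below each positive height there, and none on its boundary. -/
structure IsRegularConfig (c : ℕ → ℝ × ℝ) : Prop where
  finite : ∀ a b, {k | c k ∈ Icc 0 a ×ˢ Iic b}.Finite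
  exists_below : ∀ b, 0 < b → ∃ k, 0 ≤ (c k).1 ∧ (c k).2 ≤ b
  ne_zero : ∀ k, (c k).1 ≠ 0

/-- The `k`-th point is the leftmost point of height at most `b` in the right half-plane. -/
structure IsLeftmost (c : ℕ → ℝ × ℝ) (b : ℝ) (k : ℕ) : Prop where
  nonneg : 0 ≤ (c k).1
  le : (c k).2 ≤ b
  min : ∀ j, 0 ≤ (c j).1 → (c j).2 ≤ b → (c k).1 ≤ (c j).1

variable {c : ℕ → ℝ × ℝ} {A B b b' : ℝ} {k k' : ℕ}

namespace IsLeftmost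

lemma antitone (hk : IsLeftmost c b k) (hk' : IsLeftmost c b' k') (h : b ≤ b') :
    (c k').1 ≤ (c k).1 :=
  hk'.min k hk.nonneg (hk.le.trans h)

lemma fst_congr (hk : IsLeftmost c b k) (hk' : IsLeftmost c b' k') (hA : (c k).1 ≤ A)
    (hA' : (c k').1 ≤ A) (hB : b ≤ B) (hB' : b' ≤ B)
    (h : ∀ j ∈ {j | c j ∈ Icc 0 A ×ˢ Iic B}, ((c j).2 ≤ b ↔ (c j).2 ≤ b')) :
    (c k).1 = (c k').1 :=
  le_antisymm
    (hk.min k' hk'.nonneg ((h k' ⟨⟨hk'.nonneg, hA'⟩, hk'.le.trans hB'⟩).2 hk'.le))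
    (hk'.min k hk.nonneg ((h k ⟨⟨hk.nonneg, hA⟩, hk.le.trans hB⟩).1 hk.le))

end IsLeftmost

namespace IsRegularConfig

lemma exists_isLeftmost (hc : IsRegularConfig c) (hb : 0 < b) : ∃ k, IsLeftmost c b k := by
  obtain ⟨k₀, h0, hk₀⟩ := hc.exists_below b hb
  obtain ⟨k, hk, hmin⟩ := Set.exists_min_image _ (fun k => (c k).1) (hc.finite (c k₀).1 b)
    ⟨k₀, ⟨h0, le_rfl⟩, hk₀⟩
  refine ⟨k, hk.1.1, hk.2, fun j hj hjb => ?_⟩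
  rcases le_total (c j).1 (c k₀).1 with h | h
  · exact hmin j ⟨⟨hj, h⟩, hjb⟩
  · exact hk.1.2.trans h

lemma exists_isLeftmost_exp (hc : IsRegularConfig c) (β : ℝ) :
    ∃ k, IsLeftmost c (2 * Real.exp β) k :=
  hc.exists_isLeftmost (by positivity)

lemma pos_of_isLeftmost (hc : IsRegularConfig c) (hk : IsLeftmost c b k) : 0 < (c k).1 :=
  lt_of_le_of_ne hk.nonneg (hc.ne_zero k).symm

end IsRegularConfig

lemma eventually_nhdsGT_le_two_mul_exp_iff (u r : ℝ) :
    ∀ᶠ q in 𝓝[>] r, (u ≤ 2 * Real.exp q ↔ u ≤ 2 * Real.exp r) := by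
  have hcont : Tendsto (fun q => 2 * Real.exp q) (𝓝[>] r) (𝓝 (2 * Real.exp r)) :=
    ((by fun_prop : Continuous fun q => 2 * Real.exp q).tendsto r).mono_left nhdsWithin_le_nhds
  rcases le_or_gt u (2 * Real.exp r) with h | h
  · filter_upwards [self_mem_nhdsWithin] with q hq
    have := Real.exp_lt_exp.2 (mem_Ioi.1 hq)
    exact iff_of_true (by linarith) h
  · filter_upwards [hcont.eventually (gt_mem_nhds h)] with q hq
    exact iff_of_false (not_le.2 hq) (not_le.2 h)

lemma eventually_nhdsLT_le_two_mul_exp_iff (u r : ℝ) :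
    ∀ᶠ q in 𝓝[<] r, (u ≤ 2 * Real.exp q ↔ u < 2 * Real.exp r) := by
  have hcont : Tendsto (fun q => 2 * Real.exp q) (𝓝[<] r) (𝓝 (2 * Real.exp r)) :=
    ((by fun_prop : Continuous fun q => 2 * Real.exp q).tendsto r).mono_left nhdsWithin_le_nhds
  rcases lt_or_ge u (2 * Real.exp r) with h | h
  · filter_upwards [hcont.eventually (lt_mem_nhds h)] with q hq
    exact iff_of_true hq.le h
  · filter_upwards [self_mem_nhdsWithin] with q hq
    have := Real.exp_lt_exp.2 (mem_Iio.1 hq)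
    exact iff_of_false (not_le.2 (by linarith)) (not_lt.2 h)

end Configurations

/-! ### Poisson configurations -/

section Poisson

variable {Ω E : Type*} {X : ℕ → Ω → E} {A : Set E} {ω : Ω}

lemma pointCount_eq_zero_iff : pointCount X A ω = 0 ↔ ∀ k, X k ω ∉ A := by
  simp [pointCount, ENNReal.tsum_eq_zero, indicator_apply_eq_zero]

lemma finite_of_pointCount_ne_top (h : pointCount X A ω ≠ ∞) : {k | X k ω ∈ A}.Finite := by
  refine (ENNReal.finite_const_le_of_tsum_ne_top h one_ne_zero).subset fun k hk => ?_
  rw [mem_ofPred_eq] at hk ⊢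
  rw [indicator_of_mem hk, Pi.one_apply]

namespace IsPoissonPointProcess

variable [MeasurableSpace Ω] [MeasurableSpace E] {ν : Measure E} {P : Measure Ω}

lemma measure_void (h : IsPoissonPointProcess X ν P) (hA : MeasurableSet A) (hν : ν A ≠ ∞) :
    P {ω | ∀ k, X k ω ∉ A} = ENNReal.ofReal (Real.exp (-(ν A).toReal)) := by
  have hvoid : {ω | ∀ k, X k ω ∉ A} = {ω | pointCount X A ω = 0} := by
    ext ω; simp only [mem_ofPred_eq, pointCount_eq_zero_iff]
  have hm : MeasurableSet {x : ℝ≥0∞ | x = 0} := measurableSet_singleton 0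
  have hcast : (Nat.cast : ℕ → ℝ≥0∞) ⁻¹' {x | x = 0} = {0} := by ext n; simp
  rw [hvoid, (h.hasLaw_count A hA hν).measure_eq (p := fun x => x = 0) hm,
    Measure.map_apply .of_discrete hm, hcast, poissonMeasure_singleton,
    ENNReal.coe_toNNReal_eq_toReal, pow_zero, Nat.factorial_zero, Nat.cast_one, mul_one, div_one]

lemma ae_finite (h : IsPoissonPointProcess X ν P) (hA : MeasurableSet A) (hν : ν A ≠ ∞) :
    ∀ᵐ ω ∂P, {k | X k ω ∈ A}.Finite := by
  have hm : MeasurableSet {x : ℝ≥0∞ | x = ∞} := measurableSet_singleton ∞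
  have hcast : (Nat.cast : ℕ → ℝ≥0∞) ⁻¹' {x | x = ∞} = ∅ := by ext n; simp
  have hinfinite : P {ω | pointCount X A ω = ∞} = 0 := by
    rw [(h.hasLaw_count A hA hν).measure_eq (p := fun x => x = ∞) hm,
      Measure.map_apply .of_discrete hm, hcast, measure_empty]
  have hae : ∀ᵐ ω ∂P, pointCount X A ω ≠ ∞ := by simpa [ae_iff] using hinfinite
  exact hae.mono fun _ => finite_of_pointCount_ne_top

lemma ae_void_of_null [IsProbabilityMeasure P] (h : IsPoissonPointProcess X ν P)
    (hA : MeasurableSet A) (hν : ν A = 0) : ∀ᵐ ω ∂P, ∀ k, X k ω ∉ A := by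
  have hm : MeasurableSet {ω | ∀ k, X k ω ∉ A} :=
    measurableSet_setOfPred.2 (.forall fun k => (measurableSet_setOfPred.1 (h.measurable k hA)).not)
  refine (prob_compl_eq_zero_iff hm).2 ?_
  rw [h.measure_void hA (hν ▸ ENNReal.zero_ne_top), hν, ENNReal.toReal_zero, neg_zero,
    Real.exp_zero, ENNReal.ofReal_one]

variable {X : ℕ → Ω → ℝ × ℝ}

lemma ae_exists_below (h : IsPoissonPointProcess X pointRate P) {b : ℝ} (hb : 0 < b) :
    ∀ᵐ ω ∂P, ∃ k, 0 ≤ (X k ω).1 ∧ (X k ω).2 ≤ b := by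
  have hle : ∀ n : ℕ, P {ω | ¬∃ k, 0 ≤ (X k ω).1 ∧ (X k ω).2 ≤ b} ≤
      ENNReal.ofReal (Real.exp (-(n * b))) := by
    intro n
    have hrate : pointRate (Icc 0 (n : ℝ) ×ˢ Iic b) = ENNReal.ofReal (n * b) := by
      rw [pointRate_Icc_prod_Iic, ENNReal.ofReal_mul n.cast_nonneg]
    have hvoid := h.measure_void (measurableSet_Icc.prod measurableSet_Iic)
      (hrate.trans_ne ENNReal.ofReal_ne_top)
    rw [hrate, ENNReal.toReal_ofReal (by positivity)] at hvoid
    rw [← hvoid]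
    exact measure_mono fun ω hω k hk => hω ⟨k, hk.1.1, hk.2⟩
  have hlim : Tendsto (fun n : ℕ => ENNReal.ofReal (Real.exp (-(n * b)))) atTop (𝓝 0) := by
    rw [← ENNReal.ofReal_zero]
    exact ENNReal.tendsto_ofReal (Real.tendsto_exp_neg_atTop_nhds_zero.comp
      (tendsto_natCast_atTop_atTop.atTop_mul_const hb))
  exact le_antisymm (ge_of_tendsto' hlim hle) zero_le

lemma ae_isRegularConfig [IsProbabilityMeasure P] (h : IsPoissonPointProcess X pointRate P) :
    ∀ᵐ ω ∂P, IsRegularConfig fun k => X k ω := by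
  have hfin : ∀ᵐ ω ∂P, ∀ n : ℕ, {k | X k ω ∈ Icc 0 (n : ℝ) ×ˢ Iic (n : ℝ)}.Finite := by
    refine ae_all_iff.2 fun n => h.ae_finite (measurableSet_Icc.prod measurableSet_Iic) ?_
    rw [pointRate_Icc_prod_Iic]
    exact ENNReal.mul_ne_top ENNReal.ofReal_ne_top ENNReal.ofReal_ne_top
  have hbelow : ∀ᵐ ω ∂P, ∀ n : ℕ, ∃ k, 0 ≤ (X k ω).1 ∧ (X k ω).2 ≤ 1 / ((n : ℝ) + 1) :=
    ae_all_iff.2 fun n => h.ae_exists_below (by positivity)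
  have hzero : ∀ᵐ ω ∂P, ∀ k, X k ω ∉ ({0} : Set ℝ) ×ˢ (univ : Set ℝ) := by
    refine h.ae_void_of_null ((measurableSet_singleton 0).prod .univ) ?_
    rw [pointRate, Measure.prod_prod, Real.volume_singleton, zero_mul]
  filter_upwards [hfin, hbelow, hzero] with ω hfin hbelow hzero
  refine ⟨fun a b => ?_, fun b hb => ?_, fun k hk => hzero k ⟨hk, trivial⟩⟩
  · obtain ⟨n, hn⟩ := exists_nat_ge (max a b)
    obtain ⟨ha, hb⟩ := max_le_iff.1 hn
    exact (hfin n).subset fun k hk => ⟨⟨hk.1.1, hk.1.2.trans ha⟩, le_trans hk.2 hb⟩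
  · obtain ⟨n, hn⟩ := exists_nat_one_div_lt hb
    obtain ⟨k, hk, hkn⟩ := hbelow n
    exact ⟨k, hk, hkn.trans hn.le⟩

end IsPoissonPointProcess

end Poisson

/-! ### The distance from the origin to the interlacement -/

section Interlacement

open scoped Pointwise

variable {Ω E : Type*} [NormedAddCommGroup E] [NormedSpace ℝ E]

/-- The set `BRI(α)` built from arbitrary points `X k` and arbitrary sets `S k` in place of the
Wiener moustaches. -/
def interlacement (X : ℕ → Ω → ℝ × ℝ) (S : ℕ → Ω → Set E) (α : ℝ) (ω : Ω) : Set E :=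
  ⋃ k ∈ {k | (X k ω).2 ≤ 2 * α ∧ 1 ≤ Real.exp (X k ω).1}, Real.exp (X k ω).1 • S k ω

/-- The process `Y` of the interlacement built from the points `X k` and the sets `S k`. -/
def logLogDist (X : ℕ → Ω → ℝ × ℝ) (S : ℕ → Ω → Set E) (β : ℝ) (ω : Ω) : ℝ :=
  β + Real.log (Real.log (Metric.infDist 0 (interlacement X S (Real.exp β) ω))) + Real.log 2

/-- In the realization `ω`, the points form a regular configuration and the unscaled sets are at
distance one from the origin. -/
structure IsRegularRealization (X : ℕ → Ω → ℝ × ℝ) (S : ℕ → Ω → Set E) (ω : Ω) : Prop where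
  isRegularConfig : IsRegularConfig fun k => X k ω
  infDist_eq_one : ∀ k, Metric.infDist 0 (S k ω) = 1

lemma infDist_zero_smul {r : ℝ} (hr : 0 < r) (s : Set E) :
    Metric.infDist 0 (r • s) = r * Metric.infDist 0 s := by
  have h := infDist_smul₀ hr.ne' s 0
  rwa [smul_zero, Real.norm_of_nonneg hr.le] at h

variable {X : ℕ → Ω → ℝ × ℝ} {S : ℕ → Ω → Set E} {ω : Ω}

namespace IsRegularRealization

lemma infDist_interlacement (h : IsRegularRealization X S ω) {α : ℝ} {k : ℕ}
    (hk : IsLeftmost (fun k => X k ω) (2 * α) k) :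
    Metric.infDist 0 (interlacement X S α ω) = Real.exp (X k ω).1 := by
  have hdist : ∀ j, Metric.infDist 0 (Real.exp (X j ω).1 • S j ω) = Real.exp (X j ω).1 := fun j =>
    by rw [infDist_zero_smul (Real.exp_pos _), h.infDist_eq_one, mul_one]
  have hsub : Real.exp (X k ω).1 • S k ω ⊆ interlacement X S α ω :=
    subset_biUnion_of_mem (u := fun j => Real.exp (X j ω).1 • S j ω)
      ⟨hk.le, Real.one_le_exp_iff.2 hk.nonneg⟩
  have hne : (Real.exp (X k ω).1 • S k ω).Nonempty := by
    by_contra hempty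
    have hzero := hdist k
    rw [not_nonempty_iff_eq_empty.1 hempty, Metric.infDist_empty] at hzero
    exact (Real.exp_pos _).ne hzero
  refine le_antisymm ((Metric.infDist_le_infDist_of_subset hsub hne).trans_eq (hdist k))
    ((Metric.le_infDist (hne.mono hsub)).2 fun z hz => ?_)
  obtain ⟨j, ⟨hj, hj'⟩, hzj⟩ := mem_iUnion₂.1 hz
  calc Real.exp (X k ω).1 ≤ Real.exp (X j ω).1 :=
        Real.exp_le_exp.2 (hk.min j (Real.one_le_exp_iff.1 hj') hj)
    _ = Metric.infDist 0 (Real.exp (X j ω).1 • S j ω) := (hdist j).symm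
    _ ≤ dist 0 z := Metric.infDist_le_dist_of_mem hzj

lemma one_lt_infDist (h : IsRegularRealization X S ω) {α : ℝ} (hα : 0 < α) :
    1 < Metric.infDist 0 (interlacement X S α ω) := by
  obtain ⟨k, hk⟩ := h.isRegularConfig.exists_isLeftmost (b := 2 * α) (by positivity)
  rw [h.infDist_interlacement hk]
  exact Real.one_lt_exp_iff.2 (h.isRegularConfig.pos_of_isLeftmost hk)

lemma logLogDist_eq (h : IsRegularRealization X S ω) {β : ℝ} {k : ℕ}
    (hk : IsLeftmost (fun k => X k ω) (2 * Real.exp β) k) :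
    logLogDist X S β ω = β + Real.log (X k ω).1 + Real.log 2 := by
  rw [logLogDist, h.infDist_interlacement hk, Real.log_exp]

lemma lt_logLogDist_iff (h : IsRegularRealization X S ω) (β y : ℝ) :
    y < logLogDist X S β ω ↔ ∀ k, X k ω ∉ voidBox β y := by
  obtain ⟨k, hk⟩ := h.isRegularConfig.exists_isLeftmost_exp β
  have hpos := h.isRegularConfig.pos_of_isLeftmost hk
  have hbox : y < logLogDist X S β ω ↔ Real.exp (y - β) / 2 < (X k ω).1 := by
    rw [h.logLogDist_eq hk, div_lt_iff₀ two_pos, ← Real.lt_log_iff_exp_lt (by positivity),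
      Real.log_mul hpos.ne' two_ne_zero, sub_lt_iff_lt_add', add_assoc]
  rw [hbox]
  constructor
  · rintro hlt j ⟨⟨hj0, hj⟩, hj'⟩
    exact (hk.min j hj0 hj').not_gt (hj.trans_lt hlt)
  · intro hvoid
    by_contra hle
    exact hvoid k ⟨⟨hk.nonneg, not_lt.1 hle⟩, hk.le⟩

lemma forall_lt_logLogDist_iff (h : IsRegularRealization X S ω) (L : Finset (ℝ × ℝ)) :
    (∀ p ∈ L, p.2 < logLogDist X S p.1 ω) ↔ ∀ k, X k ω ∉ voidRegion id L := by
  simp only [h.lt_logLogDist_iff, voidRegion, mem_iUnion, not_exists]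
  exact ⟨fun H k p hp => H p hp k, fun H p hp k => H k p hp⟩

lemma antitone (h : IsRegularRealization X S ω) : Antitone fun r => logLogDist X S r ω - r := by
  intro r q hrq
  obtain ⟨k, hk⟩ := h.isRegularConfig.exists_isLeftmost_exp r
  obtain ⟨j, hj⟩ := h.isRegularConfig.exists_isLeftmost_exp q
  have hle := hk.antitone hj (by linarith [Real.exp_le_exp.2 hrq])
  have hlog := Real.log_le_log (h.isRegularConfig.pos_of_isLeftmost hj) hle
  simp only
  rw [h.logLogDist_eq hk, h.logLogDist_eq hj]
  linarith

lemma logLogDist_sub_congr (h : IsRegularRealization X S ω) {a b q q' : ℝ} {k₀ : ℕ}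
    (hk₀ : IsLeftmost (fun k => X k ω) (2 * Real.exp a) k₀) (hq : q ∈ Icc a b)
    (hq' : q' ∈ Icc a b)
    (hiff : ∀ k ∈ {k | X k ω ∈ Icc 0 (X k₀ ω).1 ×ˢ Iic (2 * Real.exp b)},
      ((X k ω).2 ≤ 2 * Real.exp q ↔ (X k ω).2 ≤ 2 * Real.exp q')) :
    logLogDist X S q ω - q = logLogDist X S q' ω - q' := by
  obtain ⟨k, hk⟩ := h.isRegularConfig.exists_isLeftmost_exp q
  obtain ⟨k', hk'⟩ := h.isRegularConfig.exists_isLeftmost_exp q'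
  have hlevel : Monotone fun r => 2 * Real.exp r := Real.exp_monotone.const_mul zero_le_two
  have hfst : (X k ω).1 = (X k' ω).1 :=
    hk.fst_congr hk' (hk₀.antitone hk (hlevel hq.1)) (hk₀.antitone hk' (hlevel hq'.1))
      (hlevel hq.2) (hlevel hq'.2) hiff
  rw [h.logLogDist_eq hk, h.logLogDist_eq hk', hfst]
  ring

lemma isDriftJumpPath (h : IsRegularRealization X S ω) :
    IsDriftJumpPath (logLogDist X S) ω := by
  intro r
  obtain ⟨k₀, hk₀⟩ := h.isRegularConfig.exists_isLeftmost_exp (r - 1)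
  have hfin := h.isRegularConfig.finite (X k₀ ω).1 (2 * Real.exp (r + 1))
  have hnear : Icc (r - 1) (r + 1) ∈ 𝓝 r := Icc_mem_nhds (by linarith) (by linarith)
  constructor
  · filter_upwards [nhdsWithin_le_nhds hnear, (eventually_all_finite hfin).2 fun k _ =>
      eventually_nhdsGT_le_two_mul_exp_iff (X k ω).2 r] with q hq hiff
    exact h.logLogDist_sub_congr hk₀ hq (mem_of_mem_nhds hnear) hiff
  · have hev : ∀ᶠ q in 𝓝[<] r, q ∈ Icc (r - 1) (r + 1) ∧
        ∀ k ∈ {k | X k ω ∈ Icc 0 (X k₀ ω).1 ×ˢ Iic (2 * Real.exp (r + 1))},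
          ((X k ω).2 ≤ 2 * Real.exp q ↔ (X k ω).2 < 2 * Real.exp r) :=
      Eventually.and (nhdsWithin_le_nhds hnear) ((eventually_all_finite hfin).2 fun k _ =>
        eventually_nhdsLT_le_two_mul_exp_iff (X k ω).2 r)
    obtain ⟨q₀, hq₀, hiff₀⟩ := hev.exists
    refine ⟨logLogDist X S q₀ ω - q₀, ?_⟩
    filter_upwards [hev] with q ⟨hq, hiff⟩
    exact h.logLogDist_sub_congr hk₀ hq hq₀ fun k hk => (hiff k hk).trans (hiff₀ k hk).symm

end IsRegularRealization

variable [MeasurableSpace Ω] {P : Measure Ω}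

lemma aemeasurable_logLogDist_path (hX : ∀ k, Measurable (X k))
    (hXS : ∀ᵐ ω ∂P, IsRegularRealization X S ω) :
    AEMeasurable (fun ω β => logLogDist X S β ω) P := by
  classical
  obtain ⟨N, hsub, hN, hN0⟩ := exists_measurable_superset_of_null (ae_iff.1 hXS)
  have hregular : ∀ ω ∉ N, IsRegularRealization X S ω := fun ω hω => by
    by_contra hbad
    exact hω (hsub hbad)
  refine ⟨fun ω β => if ω ∈ N then 0 else logLogDist X S β ω, ?_, ?_⟩
  · refine measurable_pi_lambda _ fun β => measurable_of_Ioi fun y => ?_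
    have hpreimage : (fun ω => if ω ∈ N then 0 else logLogDist X S β ω) ⁻¹' Ioi y =
        (N ∩ {_ω | y < 0}) ∪ (Nᶜ ∩ ⋂ k, (X k ⁻¹' voidBox β y)ᶜ) := by
      ext ω
      by_cases hω : ω ∈ N
      · simp [hω]
      · simp [hω, (hregular ω hω).lt_logLogDist_iff β y]
    have hbox : MeasurableSet (voidBox β y) := measurableSet_Icc.prod measurableSet_Iic
    rw [hpreimage]
    exact (hN.inter (.const _)).union (hN.compl.inter (.iInter fun k => (hX k hbox).compl))
  · filter_upwards [measure_eq_zero_iff_ae_notMem.1 hN0] with ω hω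
    simp [hω]

theorem isVoidProcess_logLogDist (hX : IsPoissonPointProcess X pointRate P)
    (hXS : ∀ᵐ ω ∂P, IsRegularRealization X S ω) : IsVoidProcess (logLogDist X S) P where
  aemeasurable_path := aemeasurable_logLogDist_path hX.measurable hXS
  void L := by
    rw [voidProb, ← hX.measure_void (measurableSet_voidRegion id L)
      (pointRate_voidRegion_lt_top id L).ne]
    refine measure_congr ?_
    filter_upwards [hXS] with ω hω
    exact propext (hω.forall_lt_logLogDist_iff L)
  path := hXS.mono fun _ hω => hω.isDriftJumpPath
  antitone := hXS.mono fun _ hω => hω.antitone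

theorem theorem2_general [IsProbabilityMeasure P] (hX : IsPoissonPointProcess X pointRate P)
    (hS : ∀ᵐ ω ∂P, ∀ k, Metric.infDist 0 (S k ω) = 1) :
    (∀ᵐ ω ∂P, ∀ α, 0 < α → 1 < Metric.infDist 0 (interlacement X S α ω)) ∧
    IsStationary (logLogDist X S) P ∧
    (∃ κ : ℝ≥0 → Kernel ℝ ℝ, IsMarkovSemigroup κ ∧ IsMarkovProcess (logLogDist X S) κ P ∧
      (∀ f : ℝ → ℝ, (∀ y, IntegrableOn (fun u => f (y - u) * Real.exp (-u)) (Ioi 0)) →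
        ∀ y, (∀ t, Integrable f (κ t y)) ∧ (DifferentiableAt ℝ f y →
          Tendsto (fun t : ℝ≥0 => ((∫ z, f z ∂(κ t y)) - f y) / (t : ℝ)) (𝓝[>] 0)
            (𝓝 (generator f y)))) ∧
      (∀ t, Kernel.Invariant (κ t) negGumbel) ∧
      ∀ ν : Measure ℝ, IsProbabilityMeasure ν → ∀ t, 0 < t → Kernel.Invariant (κ t) ν →
        ν = negGumbel) ∧
    SolvesJumpSDE (logLogDist X S) Real.exp (expMeasure 1) P ∧
    (∀ β, HasLaw (logLogDist X S β) negGumbel P) ∧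
    (∀ x : ℝ, (negGumbel.map fun y => -y) (Iic x) =
      ENNReal.ofReal (Real.exp (-Real.exp (-x)))) := by
  have hXS : ∀ᵐ ω ∂P, IsRegularRealization X S ω := by
    filter_upwards [hX.ae_isRegularConfig, hS] with ω hc hdist using ⟨hc, hdist⟩
  have hY := isVoidProcess_logLogDist hX hXS
  exact ⟨hXS.mono fun ω hω α hα => hω.one_lt_infDist hα, hY.isStationary,
    ⟨transitionKernel, isMarkovSemigroup_transitionKernel, hY.isMarkovProcess,
      fun f hfi y => ⟨fun t => integrable_transitionLaw (hfi _), tendsto_generator hfi⟩,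
      invariant_negGumbel, fun ν hν t ht h => eq_negGumbel_of_invariant ht h⟩,
    hY.solvesJumpSDE, hY.hasLaw, negGumbel_map_neg_Iic⟩

end Interlacement

/-! ### The interlacement of Wiener moustaches -/

section Moustache

variable {Ω : Type*} [MeasurableSpace Ω] {P : Measure Ω}

lemma WienerMoustache.ae_infDist_range (η : WienerMoustache P) :
    ∀ᵐ ω ∂P, Metric.infDist 0 (η.range ω) = 1 := by
  have hnorm (r θ : ℝ) : dist 0 ((r : ℂ) * Complex.exp (Complex.I * θ)) = |r| := by
    rw [dist_zero_left, norm_mul, mul_comm Complex.I, Complex.norm_exp_ofReal_mul_I, mul_one,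
      Complex.norm_real, Real.norm_eq_abs]
  filter_upwards [ae_all_iff.2 η.radius_zero, ae_all_iff.2 η.one_lt_radius] with ω hzero hlt
  have hle : ∀ j t, 1 ≤ η.radius j t ω := fun j t => by
    rcases eq_zero_or_pos t with rfl | ht
    · exact (hzero j).ge
    · exact (hlt j t ht).le
  have hmem : (η.radius 0 0 ω : ℂ) * Complex.exp (Complex.I * η.arg 0 0 ω) ∈ η.range ω :=
    ⟨0, 0, rfl⟩
  refine le_antisymm ((Metric.infDist_le_dist_of_mem hmem).trans_eq ?_)
    ((Metric.le_infDist ⟨_, hmem⟩).2 ?_)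
  · rw [hnorm, hzero, abs_one]
  · rintro _ ⟨j, t, rfl⟩
    rw [hnorm]
    exact (hle j t).trans (le_abs_self _)

namespace Model

variable (M : Model P)

lemma bri_one (α : ℝ) (ω : Ω) :
    M.bri α 1 ω = interlacement M.point (fun k => (M.moustache k).range) α ω := by
  simp only [bri, interlacement, ← image_smul, Complex.real_smul]

lemma Φ_zero (α : ℝ) (ω : Ω) :
    M.Φ 0 α ω = Metric.infDist 0 (interlacement M.point (fun k => (M.moustache k).range) α ω) := by
  rw [Φ, bri_one]

lemma Y_eq_logLogDist : M.Y = logLogDist M.point fun k => (M.moustache k).range := by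
  funext β ω
  rw [Y, logLogDist, Φ_zero]

end Model

end Moustache

end BrownianInterlacement

end

open BrownianInterlacement in
theorem theorem2 {Ω : Type*} [MeasurableSpace Ω] (P : Measure Ω) [IsProbabilityMeasure P]
    (M : Model P) :
    -- `Y` is well defined: `Φ₀(α) > 1` for all levels
    (∀ᵐ ω ∂P, ∀ α, 0 < α → 1 < M.Φ 0 α ω) ∧
    IsStationary M.Y P ∧
    (∃ κ : ℝ≥0 → Kernel ℝ ℝ, IsMarkovSemigroup κ ∧ IsMarkovProcess M.Y κ P ∧
      -- the generator, on all `C¹` functions for which its formula makes sense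
      (∀ f : ℝ → ℝ, ContDiff ℝ 1 f →
        (∀ y, IntegrableOn (fun u => f (y - u) * Real.exp (-u)) (Ioi 0)) →
        ∀ y, (∀ t, Integrable f (κ t y)) ∧
          Tendsto (fun t : ℝ≥0 => ((∫ z, f z ∂(κ t y)) - f y) / (t : ℝ)) (𝓝[>] 0)
            (𝓝 (generator f y))) ∧
      -- the unique invariant probability measure
      (∀ ν : Measure ℝ, IsProbabilityMeasure ν →
        ((∀ t, Kernel.Invariant (κ t) ν) ↔ ν = negGumbel))) ∧
    -- unit drift, jump rate `e^y`, downward jumps of law `Exp(1)`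
    SolvesJumpSDE M.Y Real.exp (expMeasure 1) P ∧
    (∀ β, HasLaw (M.Y β) negGumbel P) ∧
    -- `negGumbel` is the law of the negative of a standard Gumbel variable
    (∀ x : ℝ, (negGumbel.map fun y => -y) (Iic x) =
      ENNReal.ofReal (Real.exp (-Real.exp (-x)))) := by
  rw [M.Y_eq_logLogDist]
  simp only [M.Φ_zero]
  obtain ⟨hdist, hstat, ⟨κ, hκ, hY, hgen, hinv, huniq⟩, hrest⟩ := theorem2_general M.poisson
    (ae_all_iff.2 fun k => (M.moustache k).ae_infDist_range)
  exact ⟨hdist, hstat, ⟨κ, hκ, hY,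
    fun f hf hfi y => (hgen f hfi y).imp_right fun h => h (hf.differentiable one_ne_zero y),
    fun ν hν => ⟨fun h => huniq ν hν 1 one_pos (h 1), fun h => h ▸ hinv⟩⟩, hrest⟩
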